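/- Let $1\le\Delta<\infty$ and let $q\in(0,1]$ be the solution of $\Delta=(q+q^{-1})/2$. For $L\ge 2$ let $$H_{[1,L]}=\sum_{x=1}^{L-1}\Big[\tfrac14-S^3_xS^3_{x+1}-\Delta^{-1}\big(S^1_xS^1_{x+1}+S^2_xS^2_{x+1}\big)+\tfrac12\sqrt{1-\Delta^{-2}}\,\big(S^3_x-S^3_{x+1}\big)\Big]$$ be the Hamiltonian of the ferromagnetic spin-$1/2$ XXZ chain on $\mathcal H([1,L])=(\mathbb C^2)^{\otimes L}$, where $S^i_x$ is the spin-$1/2$ matrix $S^i$ acting on the $x$-th tensor factor. Let $\mathrm{SU}_q(2)$ act on $\mathcal H([1,L])$ through the generators $$S^3=\sum_{x=1}^L S^3_x,\qquad S^+=\sum_{x=1}^L q^{\,2\sum_{y<x}S^3_y}\,S^+_x,\qquad S^-=\sum_{x=1}^L q^{-2\sum_{y>x}S^3_y}\,S^-_x ,$$ with $S^\pm_x=S^1_x\pm iS^2_x$; these operators commute with $H_{[1,L]}$. For $0\le n\le\lfloor L/2\rfloor$ let $\mathcal H([1,L],n)$ be the sum of all irreducible subrepresentations of spin $L/2-n$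 (that is, of dimension $L-2n+1$) in $\mathcal H([1,L])$, and let $$\mathcal E(L,n)=\min\{\langle\psi,H_{[1,L]}\psi\rangle:\psi\in\mathcal H([1,L],n),\ \|\psi\|=1\}.$$ Then for all $L\ge 2$ and $1\le n\le\lfloor L/2\rfloor$ the minima $\mathcal E(L,n)$ and $\mathcal E(L+1,n)$ exist and $$\mathcal E(L+1,n)<\mathcal E(L,n).$$ -/

import Mathlib

noncomputable section

namespace XXZ

/-- Ising configurations of a spin-1/2 chain of length `L`: at each site, `0` is spin up
(`+1/2`) and `1` is spin down (`-1/2`). -/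
abbrev Config (L : ℕ) : Type := Fin L → Fin 2

/-- The Hilbert space `(ℂ²)^{⊗ L}`, with its orthonormal Ising (product) basis. -/
abbrev Space (L : ℕ) : Type := EuclideanSpace ℂ (Config L)

/-- Operators on the chain, written as matrices in the Ising basis. -/
abbrev Op (L : ℕ) : Type := Matrix (Config L) (Config L) ℂ

/-- Spin-1/2 matrices. -/
def S1 : Matrix (Fin 2) (Fin 2) ℂ := !![0, 1 / 2; 1 / 2, 0]

def S2 : Matrix (Fin 2) (Fin 2) ℂ := !![0, -Complex.I / 2; Complex.I / 2, 0]

def S3 : Matrix (Fin 2) (Fin 2) ℂ := !![1 / 2, 0; 0, -1 / 2]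

/-- Raising and lowering matrices `S¹ ± i S²`. -/
def SPlus : Matrix (Fin 2) (Fin 2) ℂ := S1 + Complex.I • S2

def SMinus : Matrix (Fin 2) (Fin 2) ℂ := S1 - Complex.I • S2

/-- The one-site operator `1 ⊗ ⋯ ⊗ A ⊗ ⋯ ⊗ 1` with `A` acting on the tensor factor `x`. -/
def site {L : ℕ} (x : Fin L) (A : Matrix (Fin 2) (Fin 2) ℂ) : Op L :=
  Matrix.of fun σ τ => if ∀ y, y ≠ x → σ y = τ y then A (σ x) (τ x) else 0

/-- The interaction `h_{x,y}` (used for `y = x + 1`):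
`1/4 - S³ₓS³ᵧ - Δ⁻¹ (S¹ₓS¹ᵧ + S²ₓS²ᵧ) + (1/2) √(1 - Δ⁻²) (S³ₓ - S³ᵧ)`. -/
def bond (Δ : ℝ) {L : ℕ} (x y : Fin L) : Op L :=
  (1 / 4 : ℂ) • (1 : Op L) - site x S3 * site y S3
    - ((Δ⁻¹ : ℝ) : ℂ) • (site x S1 * site y S1 + site x S2 * site y S2)
    + ((1 / 2 * √(1 - (Δ ^ 2)⁻¹) : ℝ) : ℂ) • (site x S3 - site y S3)

/-- The XXZ Hamiltonian with kink boundary fields: the sum of `h_{x,x+1}` over all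
nearest-neighbour pairs. -/
def hamiltonian (Δ : ℝ) (L : ℕ) : Op L :=
  ∑ x : Fin L, ∑ y : Fin L, if (x : ℕ) + 1 = (y : ℕ) then bond Δ x y else 0

/-- The deformation parameter `q ∈ (0, 1]` with `Δ = (q + q⁻¹) / 2`, for `Δ ≥ 1`. -/
def qParam (Δ : ℝ) : ℝ := Δ - √(Δ ^ 2 - 1)

/-- For `Δ ≥ 1`, `qParam Δ` is the one and only `q ∈ (0, 1]` with `Δ = (q + q⁻¹) / 2`. -/
theorem qParam_unique {Δ : ℝ} (hΔ : 1 ≤ Δ) (q : ℝ) :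
    (0 < q ∧ q ≤ 1 ∧ Δ = (q + q⁻¹) / 2) ↔ q = qParam Δ := by
  have h0 : 0 ≤ Δ ^ 2 - 1 := by nlinarith
  have hs := Real.sq_sqrt h0
  have hn := Real.sqrt_nonneg (Δ ^ 2 - 1)
  have key : ∀ q : ℝ, q ≠ 0 → (Δ = (q + q⁻¹) / 2 ↔ (Δ - q) ^ 2 = Δ ^ 2 - 1) := by
    intro q hq
    constructor
    · intro h
      have h2 : Δ * (2 * q) = q ^ 2 + 1 := by
        rw [h]; field_simp
      nlinarith
    · intro h
      field_simp
      nlinarith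
  constructor
  · rintro ⟨h1, h2, h3⟩
    have h4 := (key q h1.ne').1 h3
    have : √(Δ ^ 2 - 1) = Δ - q := by
      rw [← h4]; exact Real.sqrt_sq (by linarith)
    simp [qParam, this]
  · intro h
    have hpos : 0 < q := by
      rw [h, qParam]
      have : √(Δ ^ 2 - 1) < Δ := by
        rw [Real.sqrt_lt' (by linarith)]; linarith
      linarith
    refine ⟨hpos, ?_, (key q hpos.ne').2 ?_⟩
    · rw [h, qParam]
      have : Δ - 1 ≤ √(Δ ^ 2 - 1) := Real.le_sqrt_of_sq_le (by nlinarith)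
      linarith
    · rw [h, qParam]; simpa using hs

/-- Twice the third spin component of a spin value: `+1` for up, `-1` for down. -/
def twoSpin (s : Fin 2) : ℤ := if s = 0 then 1 else -1

/-- The diagonal operator `q ^ (2 ∑_{y ∈ A} S³ᵧ)`. -/
def qPow (q : ℝ) {L : ℕ} (A : Finset (Fin L)) : Op L :=
  Matrix.diagonal fun σ => ((q ^ (∑ y ∈ A, twoSpin (σ y)) : ℝ) : ℂ)

/-- The third generator of `SU_q(2)` on the chain: `∑ₓ S³ₓ`. -/
def total3 (L : ℕ) : Op L := ∑ x : Fin L, site x S3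

/-- The raising generator of `SU_q(2)` on the chain: `∑ₓ q ^ (2 ∑_{y < x} S³ᵧ) S⁺ₓ`. -/
def totalPlus (q : ℝ) (L : ℕ) : Op L :=
  ∑ x : Fin L, qPow q (Finset.Iio x) * site x SPlus

/-- The lowering generator of `SU_q(2)` on the chain: `∑ₓ q ^ (-2 ∑_{y > x} S³ᵧ) S⁻ₓ`. -/
def totalMinus (q : ℝ) (L : ℕ) : Op L :=
  ∑ x : Fin L, qPow q⁻¹ (Finset.Ioi x) * site x SMinus

/-- `W` is stable under the three generators, i.e. a subrepresentation of `SU_q(2)`. -/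
def IsInvariant (q : ℝ) {L : ℕ} (W : Submodule ℂ (Space L)) : Prop :=
  ∀ ψ ∈ W, Matrix.toEuclideanLin (total3 L) ψ ∈ W ∧
    Matrix.toEuclideanLin (totalPlus q L) ψ ∈ W ∧
    Matrix.toEuclideanLin (totalMinus q L) ψ ∈ W

/-- `W` is an irreducible subrepresentation of `SU_q(2)`. -/
def IsIrreducible (q : ℝ) {L : ℕ} (W : Submodule ℂ (Space L)) : Prop :=
  IsInvariant q W ∧ W ≠ ⊥ ∧ ∀ U : Submodule ℂ (Space L), U ≤ W → IsInvariant q U → U = ⊥ ∨ U = W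

/-- The sector `𝓗([1,L], n)`: the sum of all irreducible subrepresentations of spin `L/2 - n`,
that is, of dimension `2 (L/2 - n) + 1 = L + 1 - 2 n`. -/
def sector (q : ℝ) (L n : ℕ) : Submodule ℂ (Space L) :=
  sSup {W | IsIrreducible q W ∧ Module.finrank ℂ W + 2 * n = L + 1}

/-- The energies `⟨ψ, H ψ⟩` of the unit vectors of the sector (they are real). -/
def energies (Δ : ℝ) (L n : ℕ) : Set ℝ :=
  {e | ∃ ψ ∈ sector (qParam Δ) L n, ‖ψ‖ = 1 ∧
    inner ℂ ψ (Matrix.toEuclideanLin (hamiltonian Δ L) ψ) = (e : ℂ)}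

/-- The minimal energy `𝓔(L, n)` of the sector. -/
def minEnergy (Δ : ℝ) (L n : ℕ) : ℝ := sInf (energies Δ L n)

end XXZ

end

/-!
The interaction of two neighbouring sites is the orthogonal projection onto the `q`-singlet
`|↑↓⟩ - q |↓↑⟩` (`bond_mulVec`), so the Hamiltonian is a sum of Temperley–Lieb generators and
commutes with `SU_q(2)`. The sector of spin `L / 2 - n` is obtained by lowering from its highest
weight vectors (`sector_eq_tower`), and every energy level of the sector already has an eigenvector
among these (`exists_top_eigenvector`).

The highest weight vectors with `n` down spins are spanned by the Temperley–Lieb diagrams with `n`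
noncrossing arcs, none of them above an unpaired site (`IsHighest.mem_span`). On diagrams the
Hamiltonian is of Perron–Frobenius type: an interaction term multiplies a diagram by `1`, kills it,
or maps it to a negative multiple of another diagram (`hop_diag`), and all diagrams are connected
in this way (`reach_diag`). A diagram on `L` sites becomes one on `L + 1` sites by an additional
unpaired site; the additional interaction term never fixes such a diagram, so on the cone spanned
by the diagrams a constant minus the Hamiltonian can only increase with `L`
(`shift_succ_sub_mem`). By irreducibility a power of it increases strictly
(`exists_gain`).

This yields a strict inequality of the largest eigenvalues without a Perron vector, and without
linear independence of the diagrams: a product functional is positive on all diagrams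
(`evalAt_diag`), so on the cone it is comparable to the norm (`exists_norm_le_evalAt`), and the
powers of the operator of the longer chain grow at a strictly larger exponential rate than the
largest eigenvalue for the shorter chain allows (`exists_growth`). On the other hand the growth is
bounded by the largest eigenvalue for the longer chain (`norm_pow_apply_le`).

Chains of all lengths are embedded into one half-infinite chain by adding up spins on the right, so
that a diagram on `L` sites literally is a diagram on `L + 1` sites. Operators on this chain are
defined by recursion on the first site, which makes their relations inductions with a small base
case.
-/

noncomputable section

namespace XXZ

/-! ### The infinite chain -/

/-- Functions of the spins of a half-infinite chain. A vector `ψ` of a chain of length `L` is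
regarded as the vector `ψ ⊗ up ⊗ up ⊗ ⋯`, so that chains of all lengths live in one space. -/
abbrev Chain : Type := (ℕ → Fin 2) → ℂ

/-- The configuration `c` followed by `σ`. -/
def push (c : Fin 2) (σ : ℕ → Fin 2) : ℕ → Fin 2
  | 0 => c
  | y + 1 => σ y

/-- The configuration with its first site deleted. -/
def tail (σ : ℕ → Fin 2) : ℕ → Fin 2 := fun y => σ (y + 1)

@[simp] theorem push_zero (c : Fin 2) (σ : ℕ → Fin 2) : push c σ 0 = c := rfl

@[simp] theorem push_succ (c : Fin 2) (σ : ℕ → Fin 2) (y : ℕ) : push c σ (y + 1) = σ y := rfl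

@[simp] theorem tail_push (c : Fin 2) (σ : ℕ → Fin 2) : tail (push c σ) = σ := rfl

@[simp] theorem push_tail (σ : ℕ → Fin 2) : push (σ 0) (tail σ) = σ := by
  funext y; cases y <;> rfl

theorem update_push_zero (c a : Fin 2) (σ : ℕ → Fin 2) :
    Function.update (push c σ) 0 a = push a σ := by
  funext y; cases y <;> simp

theorem update_push_succ (c a : Fin 2) (σ : ℕ → Fin 2) (x : ℕ) :
    Function.update (push c σ) (x + 1) a = push c (Function.update σ x a) := by
  funext y; cases y <;> simp [Function.update_apply]

/-- Contraction of the first site with the basis vector `c`. -/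
def slice (c : Fin 2) : Module.End ℂ Chain where
  toFun f := fun σ => f (push c σ)
  map_add' _ _ := rfl
  map_smul' _ _ := rfl

theorem slice_apply (c : Fin 2) (f : Chain) (σ : ℕ → Fin 2) : slice c f σ = f (push c σ) := rfl

/-- Insertion of a new first site in the state `c`. -/
def glue (c : Fin 2) : Module.End ℂ Chain where
  toFun f := fun σ => if σ 0 = c then f (tail σ) else 0
  map_add' f g := by funext σ; by_cases h : σ 0 = c <;> simp [h]
  map_smul' a f := by funext σ; by_cases h : σ 0 = c <;> simp [h]

theorem glue_apply (c : Fin 2) (f : Chain) (σ : ℕ → Fin 2) :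
    glue c f σ = if σ 0 = c then f (tail σ) else 0 := rfl

theorem slice_glue (c d : Fin 2) (f : Chain) :
    slice c (glue d f) = if c = d then f else 0 := by
  funext σ; by_cases h : c = d <;> simp [slice_apply, glue_apply, h]

@[simp] theorem slice_glue_same (c : Fin 2) (f : Chain) : slice c (glue c f) = f := by
  simp [slice_glue]

@[simp] theorem slice_zero_glue_one (f : Chain) : slice 0 (glue 1 f) = 0 := by
  simp [slice_glue]

@[simp] theorem slice_one_glue_zero (f : Chain) : slice 1 (glue 0 f) = 0 := by
  simp [slice_glue]

theorem chain_ext {f g : Chain} (h0 : slice 0 f = slice 0 g) (h1 : slice 1 f = slice 1 g) :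
    f = g := by
  funext σ
  have h : ∀ c, slice c f = slice c g := by
    intro c; fin_cases c
    · exact h0
    · exact h1
  have := congrFun (h (σ 0)) (tail σ)
  simpa [slice_apply] using this

/-- The operator acting as `T` on all sites but the first one. -/
def under (T : Module.End ℂ Chain) : Module.End ℂ Chain :=
  glue 0 * T * slice 0 + glue 1 * T * slice 1

@[simp] theorem slice_under (c : Fin 2) (T : Module.End ℂ Chain) (f : Chain) :
    slice c (under T f) = T (slice c f) := by
  fin_cases c <;> simp [under]

/-! ### The Temperley–Lieb operators -/

/-- Insertion of the `q`-singlet `|↑↓⟩ - q |↓↑⟩` at the new sites `x`, `x + 1`. -/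
def cup (q : ℂ) : ℕ → Module.End ℂ Chain
  | 0 => glue 0 * glue 1 - q • (glue 1 * glue 0)
  | x + 1 => under (cup q x)

/-- Contraction of the sites `x`, `x + 1` with the `q`-singlet. -/
def cap (q : ℂ) : ℕ → Module.End ℂ Chain
  | 0 => slice 1 * slice 0 - q • (slice 0 * slice 1)
  | x + 1 => under (cap q x)

theorem cup_succ (q : ℂ) (x : ℕ) : cup q (x + 1) = under (cup q x) := rfl

theorem cap_succ (q : ℂ) (x : ℕ) : cap q (x + 1) = under (cap q x) := rfl

theorem slice_zero_cup_zero (q : ℂ) (f : Chain) : slice 0 (cup q 0 f) = glue 1 f := by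
  simp [cup]

theorem slice_one_cup_zero (q : ℂ) (f : Chain) : slice 1 (cup q 0 f) = -(q • glue 0 f) := by
  simp [cup]

@[simp] theorem slice_cup_succ (q : ℂ) (c : Fin 2) (x : ℕ) (f : Chain) :
    slice c (cup q (x + 1) f) = cup q x (slice c f) := by
  simp [cup_succ]

@[simp] theorem slice_cap_succ (q : ℂ) (c : Fin 2) (x : ℕ) (f : Chain) :
    slice c (cap q (x + 1) f) = cap q x (slice c f) := by
  simp [cap_succ]

theorem cap_zero_apply (q : ℂ) (f : Chain) :
    cap q 0 f = slice 1 (slice 0 f) - q • slice 0 (slice 1 f) := by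
  simp [cap]

theorem cap_cup_self (q : ℂ) (x : ℕ) (f : Chain) :
    cap q x (cup q x f) = (1 + q ^ 2) • f := by
  induction x generalizing f with
  | zero =>
    simp only [cap_zero_apply, slice_zero_cup_zero, slice_one_cup_zero, map_neg, map_smul,
      slice_glue_same]
    module
  | succ x ih => apply chain_ext <;> simp [ih]

theorem cap_cup_succ (q : ℂ) (x : ℕ) (f : Chain) :
    cap q x (cup q (x + 1) f) = (-q) • f := by
  induction x generalizing f with
  | zero =>
    apply chain_ext <;>
    simp [cap_zero_apply, slice_zero_cup_zero, slice_one_cup_zero]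
  | succ x ih => apply chain_ext <;> simp [ih]

theorem cap_succ_cup (q : ℂ) (x : ℕ) (f : Chain) :
    cap q (x + 1) (cup q x f) = (-q) • f := by
  induction x generalizing f with
  | zero =>
    apply chain_ext <;>
    simp [cap_zero_apply, slice_zero_cup_zero, slice_one_cup_zero]
  | succ x ih => apply chain_ext <;> simp [ih]

theorem cap_far_cup (q : ℂ) {x y : ℕ} (h : x ≤ y) (f : Chain) :
    cap q (y + 2) (cup q x f) = cup q x (cap q y f) := by
  induction x generalizing f y with
  | zero =>
    apply chain_ext <;> apply chain_ext <;>
    simp [slice_zero_cup_zero, slice_one_cup_zero]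
  | succ x ih =>
    obtain ⟨y, rfl⟩ : ∃ z, y = z + 1 := ⟨y - 1, by omega⟩
    apply chain_ext <;> simp [ih (Nat.le_of_succ_le_succ h)]

theorem cap_cup_far (q : ℂ) {x y : ℕ} (h : x ≤ y) (f : Chain) :
    cap q x (cup q (y + 2) f) = cup q y (cap q x f) := by
  induction x generalizing f y with
  | zero =>
    simp [cap_zero_apply]
  | succ x ih =>
    obtain ⟨y, rfl⟩ : ∃ z, y = z + 1 := ⟨y - 1, by omega⟩
    apply chain_ext <;> simp [ih (Nat.le_of_succ_le_succ h)]

theorem cup_far_cup (q : ℂ) {x y : ℕ} (h : x ≤ y) (f : Chain) :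
    cup q (y + 2) (cup q x f) = cup q x (cup q y f) := by
  induction x generalizing f y with
  | zero =>
    apply chain_ext <;> apply chain_ext <;>
    simp [slice_zero_cup_zero, slice_one_cup_zero]
  | succ x ih =>
    obtain ⟨y, rfl⟩ : ∃ z, y = z + 1 := ⟨y - 1, by omega⟩
    apply chain_ext <;> simp [ih (Nat.le_of_succ_le_succ h)]

/-- The nearest-neighbour interaction of the sites `x`, `x + 1`: the orthogonal projection onto
the `q`-singlet. -/
def hop (q : ℂ) (x : ℕ) : Module.End ℂ Chain := (1 + q ^ 2)⁻¹ • (cup q x * cap q x)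

theorem hop_apply (q : ℂ) (x : ℕ) (f : Chain) :
    hop q x f = (1 + q ^ 2)⁻¹ • cup q x (cap q x f) := rfl

theorem hop_cup_self {q : ℂ} (hq : 1 + q ^ 2 ≠ 0) (x : ℕ) (f : Chain) :
    hop q x (cup q x f) = cup q x f := by
  rw [hop_apply, cap_cup_self, map_smul, smul_smul, inv_mul_cancel₀ hq, one_smul]

theorem hop_cup_succ (q : ℂ) (x : ℕ) (f : Chain) :
    hop q x (cup q (x + 1) f) = (-(q / (1 + q ^ 2))) • cup q x f := by
  rw [hop_apply, cap_cup_succ, map_smul, smul_smul]; congr 1; ring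

theorem hop_succ_cup (q : ℂ) (x : ℕ) (f : Chain) :
    hop q (x + 1) (cup q x f) = (-(q / (1 + q ^ 2))) • cup q (x + 1) f := by
  rw [hop_apply, cap_succ_cup, map_smul, smul_smul]; congr 1; ring

theorem hop_far_cup (q : ℂ) {x y : ℕ} (h : x ≤ y) (f : Chain) :
    hop q (y + 2) (cup q x f) = cup q x (hop q y f) := by
  simp only [hop_apply, cap_far_cup q h, cup_far_cup q h, map_smul]

theorem hop_cup_far (q : ℂ) {x y : ℕ} (h : x ≤ y) (f : Chain) :
    hop q x (cup q (y + 2) f) = cup q (y + 2) (hop q x f) := by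
  simp only [hop_apply, cap_cup_far q h, cup_far_cup q h, map_smul]

/-! ### The quantum group generators -/

/-- Twice the third spin component of the first `L` sites. -/
def weight : ℕ → (ℕ → Fin 2) → ℤ
  | 0, _ => 0
  | L + 1, σ => twoSpin (σ 0) + weight L (tail σ)

/-- Multiplication by a function of `weight L`. -/
def mulWeight (u : ℤ → ℂ) (L : ℕ) : Module.End ℂ Chain where
  toFun f := fun σ => u (weight L σ) * f σ
  map_add' f g := by funext σ; simp [mul_add]
  map_smul' a f := by funext σ; simp [mul_left_comm]

theorem mulWeight_apply (u : ℤ → ℂ) (L : ℕ) (f : Chain) (σ : ℕ → Fin 2) :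
    mulWeight u L f σ = u (weight L σ) * f σ := rfl

theorem slice_mulWeight (u : ℤ → ℂ) (L : ℕ) (c : Fin 2) (f : Chain) :
    slice c (mulWeight u (L + 1) f) = mulWeight (fun w => u (w + twoSpin c)) L (slice c f) := by
  funext σ
  simp [slice_apply, mulWeight_apply, weight, add_comm]

theorem slice_zero_mulWeight (u : ℤ → ℂ) (L : ℕ) (f : Chain) :
    slice 0 (mulWeight u (L + 1) f) = mulWeight (fun w => u (w + 1)) L (slice 0 f) := by
  rw [slice_mulWeight]; rfl

theorem slice_one_mulWeight (u : ℤ → ℂ) (L : ℕ) (f : Chain) :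
    slice 1 (mulWeight u (L + 1) f) = mulWeight (fun w => u (w - 1)) L (slice 1 f) := by
  rw [slice_mulWeight]; rfl

/-- The raising generator of the first `L` sites. -/
def raise (q : ℂ) : ℕ → Module.End ℂ Chain
  | 0 => 0
  | L + 1 => glue 0 * (q • (raise q L * slice 0) + slice 1) + glue 1 * (q⁻¹ • (raise q L * slice 1))

/-- The lowering generator of the first `L` sites. -/
def lower (q : ℂ) : ℕ → Module.End ℂ Chain
  | 0 => 0
  | L + 1 => glue 0 * (lower q L * slice 0)
      + glue 1 * (lower q L * slice 1 + mulWeight (fun w => q ^ (-w)) L * slice 0)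

theorem slice_zero_raise (q : ℂ) (L : ℕ) (f : Chain) :
    slice 0 (raise q (L + 1) f) = q • raise q L (slice 0 f) + slice 1 f := by
  simp [raise]

theorem slice_one_raise (q : ℂ) (L : ℕ) (f : Chain) :
    slice 1 (raise q (L + 1) f) = q⁻¹ • raise q L (slice 1 f) := by
  simp [raise]

theorem slice_zero_lower (q : ℂ) (L : ℕ) (f : Chain) :
    slice 0 (lower q (L + 1) f) = lower q L (slice 0 f) := by
  simp [lower]

theorem slice_one_lower (q : ℂ) (L : ℕ) (f : Chain) :
    slice 1 (lower q (L + 1) f)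
      = lower q L (slice 1 f) + mulWeight (fun w => q ^ (-w)) L (slice 0 f) := by
  simp [lower]

theorem raise_mulWeight (q : ℂ) (u : ℤ → ℂ) (L : ℕ) (f : Chain) :
    raise q L (mulWeight u L f) = mulWeight (fun w => u (w - 2)) L (raise q L f) := by
  induction L generalizing u f with
  | zero => simp [raise]
  | succ L ih =>
    apply chain_ext
    · simp only [slice_zero_raise, slice_zero_mulWeight, slice_one_mulWeight, ih, map_add,
        map_smul]
      ring_nf
    · simp only [slice_one_raise, slice_one_mulWeight, ih, map_smul]
      ring_nf

theorem mulWeight_mulWeight (u v : ℤ → ℂ) (L : ℕ) (f : Chain) :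
    mulWeight u L (mulWeight v L f) = mulWeight (fun w => u w * v w) L f := by
  funext σ; simp [mulWeight_apply, mul_assoc]

theorem mulWeight_add (u v : ℤ → ℂ) (L : ℕ) (f : Chain) :
    mulWeight (fun w => u w + v w) L f = mulWeight u L f + mulWeight v L f := by
  funext σ; simp [mulWeight_apply, add_mul]

theorem mulWeight_smul (a : ℂ) (u : ℤ → ℂ) (L : ℕ) (f : Chain) :
    mulWeight (fun w => a * u w) L f = a • mulWeight u L f := by
  funext σ; simp [mulWeight_apply, mul_assoc]

theorem lower_mulWeight (q : ℂ) (u : ℤ → ℂ) (L : ℕ) (f : Chain) :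
    lower q L (mulWeight u L f) = mulWeight (fun w => u (w + 2)) L (lower q L f) := by
  induction L generalizing u f with
  | zero => simp [lower]
  | succ L ih =>
    apply chain_ext
    · simp only [slice_zero_lower, slice_zero_mulWeight, ih]
      ring_nf
    · simp only [slice_one_lower, slice_zero_mulWeight, slice_one_mulWeight, ih, map_add,
        mulWeight_mulWeight]
      ring_nf
      simp only [mul_comm]

/-- The commutator of the generators is the `q`-number of twice the third spin component. -/
theorem raise_lower {q : ℂ} (hq : q ≠ 0) {g : ℤ → ℂ} (g0 : g 0 = 0)
    (hg : ∀ w, g (w + 1) = q * g w + q ^ (-w)) (L : ℕ) (f : Chain) :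
    raise q L (lower q L f) = lower q L (raise q L f) + mulWeight g L f := by
  induction L generalizing f with
  | zero => funext σ; simp [raise, lower, mulWeight_apply, weight, g0]
  | succ L ih =>
    have hg' : ∀ w, g (w - 1) = q⁻¹ * g w + (-1) * q ^ (-w) := by
      intro w
      have h := hg (w - 1)
      have hp : q ^ (-(w - 1)) = q * q ^ (-w) := by
        rw [show -(w - 1) = 1 + -w by ring, zpow_add₀ hq, zpow_one]
      rw [sub_add_cancel, hp] at h
      rw [h]; field_simp; ring
    have hp2 : ∀ w : ℤ, q ^ (-(w - 2)) = q ^ 2 * q ^ (-w) := by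
      intro w
      rw [show -(w - 2) = 2 + -w by ring, zpow_add₀ hq]; rfl
    apply chain_ext
    · simp only [map_add, slice_zero_raise, slice_zero_lower, slice_one_lower, ih,
        slice_zero_mulWeight, hg, mulWeight_add, mulWeight_smul, map_smul]
      module
    · simp only [map_add, slice_zero_raise, slice_one_raise, slice_one_lower, ih,
        slice_one_mulWeight, hg', mulWeight_add, mulWeight_smul, map_smul, raise_mulWeight, hp2,
        smul_add, smul_smul]
      rw [show q⁻¹ * q ^ 2 = q by field_simp]
      module

theorem mulWeight_cup (q : ℂ) (u : ℤ → ℂ) {L x : ℕ} (h : x ≤ L) (f : Chain) :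
    mulWeight u (L + 2) (cup q x f) = cup q x (mulWeight u L f) := by
  induction x generalizing u L f with
  | zero =>
    apply chain_ext <;> apply chain_ext <;>
    simp [slice_zero_cup_zero, slice_one_cup_zero, slice_zero_mulWeight, slice_one_mulWeight]
  | succ x ih =>
    obtain ⟨L, rfl⟩ : ∃ z, L = z + 1 := ⟨L - 1, by omega⟩
    apply chain_ext <;>
    simp [slice_zero_mulWeight, slice_one_mulWeight, ih _ (Nat.le_of_succ_le_succ h)]

theorem mulWeight_cap (q : ℂ) (u : ℤ → ℂ) {L x : ℕ} (h : x ≤ L) (f : Chain) :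
    mulWeight u L (cap q x f) = cap q x (mulWeight u (L + 2) f) := by
  induction x generalizing u L f with
  | zero =>
    simp [cap_zero_apply, slice_zero_mulWeight, slice_one_mulWeight]
  | succ x ih =>
    obtain ⟨L, rfl⟩ : ∃ z, L = z + 1 := ⟨L - 1, by omega⟩
    apply chain_ext <;>
    simp [slice_zero_mulWeight, slice_one_mulWeight, ih _ (Nat.le_of_succ_le_succ h)]

theorem raise_cup {q : ℂ} (hq : q ≠ 0) {L x : ℕ} (h : x ≤ L) (f : Chain) :
    raise q (L + 2) (cup q x f) = cup q x (raise q L f) := by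
  induction x generalizing L f with
  | zero =>
    apply chain_ext <;> apply chain_ext <;>
    simp [slice_zero_cup_zero, slice_one_cup_zero, slice_zero_raise, slice_one_raise, hq]
  | succ x ih =>
    obtain ⟨L, rfl⟩ : ∃ z, L = z + 1 := ⟨L - 1, by omega⟩
    apply chain_ext <;>
    simp [slice_zero_raise, slice_one_raise, ih (Nat.le_of_succ_le_succ h)]

theorem raise_cap {q : ℂ} (hq : q ≠ 0) {L x : ℕ} (h : x ≤ L) (f : Chain) :
    raise q L (cap q x f) = cap q x (raise q (L + 2) f) := by
  induction x generalizing L f with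
  | zero =>
    simp [cap_zero_apply, slice_zero_raise, slice_one_raise, hq]
  | succ x ih =>
    obtain ⟨L, rfl⟩ : ∃ z, L = z + 1 := ⟨L - 1, by omega⟩
    apply chain_ext <;>
    simp [slice_zero_raise, slice_one_raise, ih (Nat.le_of_succ_le_succ h)]

theorem lower_cup {q : ℂ} (hq : q ≠ 0) {L x : ℕ} (h : x ≤ L) (f : Chain) :
    lower q (L + 2) (cup q x f) = cup q x (lower q L f) := by
  induction x generalizing L f with
  | zero =>
    have hp : ∀ w : ℤ, q ^ (-(w - 1)) = q * q ^ (-w) := by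
      intro w
      rw [show -(w - 1) = 1 + -w by ring, zpow_add₀ hq, zpow_one]
    apply chain_ext <;> apply chain_ext <;>
    simp only [slice_zero_cup_zero, slice_one_cup_zero, slice_zero_lower, slice_one_lower,
      slice_one_mulWeight, slice_zero_mulWeight, slice_glue_same, slice_zero_glue_one,
      slice_one_glue_zero, map_neg, map_smul, map_zero, map_add, hp, mulWeight_smul] <;> simp
  | succ x ih =>
    obtain ⟨L, rfl⟩ : ∃ z, L = z + 1 := ⟨L - 1, by omega⟩
    apply chain_ext <;>
    simp [slice_zero_lower, slice_one_lower, ih (Nat.le_of_succ_le_succ h),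
      mulWeight_cup q _ (Nat.le_of_succ_le_succ h)]

theorem lower_cap {q : ℂ} (hq : q ≠ 0) {L x : ℕ} (h : x ≤ L) (f : Chain) :
    lower q L (cap q x f) = cap q x (lower q (L + 2) f) := by
  induction x generalizing L f with
  | zero =>
    have hp : ∀ w : ℤ, q ^ (-(w + 1)) = q⁻¹ * q ^ (-w) := by
      intro w
      rw [show -(w + 1) = -1 + -w by ring, zpow_add₀ hq, zpow_neg_one]
    simp only [cap_zero_apply, slice_zero_lower, slice_one_lower, map_sub, map_add, map_smul,
      slice_zero_mulWeight, hp, mulWeight_smul, smul_add, smul_smul, mul_inv_cancel₀ hq]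
    module
  | succ x ih =>
    obtain ⟨L, rfl⟩ : ∃ z, L = z + 1 := ⟨L - 1, by omega⟩
    apply chain_ext <;>
    simp [slice_zero_lower, slice_one_lower, ih (Nat.le_of_succ_le_succ h),
      mulWeight_cap q _ (Nat.le_of_succ_le_succ h)]

theorem raise_hop {q : ℂ} (hq : q ≠ 0) {L x : ℕ} (h : x + 2 ≤ L) (f : Chain) :
    raise q L (hop q x f) = hop q x (raise q L f) := by
  obtain ⟨L, rfl⟩ : ∃ z, L = z + 2 := ⟨L - 2, by omega⟩
  have h : x ≤ L := by omega
  simp only [hop_apply, map_smul, raise_cup hq h, raise_cap hq h]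

theorem lower_hop {q : ℂ} (hq : q ≠ 0) {L x : ℕ} (h : x + 2 ≤ L) (f : Chain) :
    lower q L (hop q x f) = hop q x (lower q L f) := by
  obtain ⟨L, rfl⟩ : ∃ z, L = z + 2 := ⟨L - 2, by omega⟩
  have h : x ≤ L := by omega
  simp only [hop_apply, map_smul, lower_cup hq h, lower_cap hq h]

theorem mulWeight_hop (q : ℂ) (u : ℤ → ℂ) {L x : ℕ} (h : x + 2 ≤ L) (f : Chain) :
    mulWeight u L (hop q x f) = hop q x (mulWeight u L f) := by
  obtain ⟨L, rfl⟩ : ∃ z, L = z + 2 := ⟨L - 2, by omega⟩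
  have h : x ≤ L := by omega
  simp only [hop_apply, map_smul, mulWeight_cup q u h, mulWeight_cap q u h]

/-! ### Representations of the quantum group -/

/-- The `q`-number `[w] = (q ^ w - q ^ (-w)) / (q - q⁻¹)`, with its limit value `w` at `q = 1`. -/
def qNum (q : ℝ) (w : ℤ) : ℝ := if q = 1 then w else (q ^ w - q ^ (-w)) / (q - q⁻¹)

theorem sub_inv_ne_zero {q : ℝ} (hq : 0 < q) (h1 : q ≠ 1) : q - q⁻¹ ≠ 0 := by
  intro h
  have h2 : q = q⁻¹ := sub_eq_zero.1 h
  have h3 : q * q = 1 := by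
    nth_rewrite 2 [h2]; exact mul_inv_cancel₀ hq.ne'
  exact h1 (by nlinarith)

theorem qNum_zero (q : ℝ) : qNum q 0 = 0 := by simp [qNum]

theorem qNum_add_one {q : ℝ} (hq : 0 < q) (w : ℤ) :
    qNum q (w + 1) = q * qNum q w + q ^ (-w) := by
  unfold qNum
  split_ifs with h
  · simp [h]
  · have h2 := sub_inv_ne_zero hq h
    have h3 : q ^ (-(w + 1)) = q⁻¹ * q ^ (-w) := by
      rw [show -(w + 1) = -1 + -w by ring, zpow_add₀ hq.ne', zpow_neg_one]
    rw [h3, zpow_add_one₀ hq.ne', ← mul_div_assoc, div_add' _ _ _ h2, div_left_inj' h2]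
    generalize q ^ w = a
    generalize q ^ (-w) = b
    ring

theorem qNum_ne_zero {q : ℝ} (hq : 0 < q) {w : ℤ} (hw : w ≠ 0) : qNum q w ≠ 0 := by
  unfold qNum
  split_ifs with h
  · exact_mod_cast hw
  · refine div_ne_zero (fun h3 => hw ?_) (sub_inv_ne_zero hq h)
    have h4 : w = -w := zpow_right_injective₀ hq h (sub_eq_zero.1 h3)
    omega

theorem qNum_mul_qNum {q : ℝ} (hq : 0 < q) (k m : ℤ) :
    qNum q (k + 1) * qNum q (m - k) =
      qNum q k * qNum q (m - (k - 1)) + qNum q (m - 2 * k) := by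
  unfold qNum
  split_ifs with h
  · push_cast; ring
  · have h2 := sub_inv_ne_zero hq h
    have e1 : m - (k - 1) = m - k + 1 := by ring
    have e2 : m - 2 * k = (m - k) + -k := by ring
    rw [e1, e2]
    generalize m - k = j
    rw [show -(k + 1) = -k + -1 by ring, show -(j + 1) = -j + -1 by ring,
      show -(j + -k) = -j + k by ring]
    simp only [zpow_add₀ hq.ne', zpow_neg_one, zpow_one]
    have a1 : q ^ k * q ^ (-k) = 1 := by rw [← zpow_add₀ hq.ne']; simp
    have a2 : q ^ j * q ^ (-j) = 1 := by rw [← zpow_add₀ hq.ne']; simp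
    rw [div_mul_div_comm, div_mul_div_comm, div_add_div _ _ (mul_ne_zero h2 h2) h2,
      div_eq_div_iff (mul_ne_zero h2 h2) (mul_ne_zero (mul_ne_zero h2 h2) h2)]
    ring

variable {V : Type*} [AddCommGroup V] [Module ℂ V]

/-- `D`, `E`, `F` satisfy the relations of twice the third, the raising and the lowering
generator of `SU_q(2)`, and the eigenvalues of `D` are among `L, L - 2, …, -L`. -/
structure IsRep (q : ℝ) (L : ℕ) (D E F : Module.End ℂ V) : Prop where
  D_E : ∀ v, D (E v) = E (D v) + (2 : ℂ) • E v
  D_F : ∀ v, D (F v) = F (D v) - (2 : ℂ) • F v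
  E_F : ∀ (m : ℤ) (v), D v = (m : ℂ) • v → E (F v) = F (E v) + (qNum q m : ℂ) • v
  spectrum : ∀ (μ : ℂ) (v), v ≠ 0 → D v = μ • v → ∃ n : ℕ, n ≤ L ∧ μ = L - 2 * n

/-- The vectors of weight `m` that are annihilated by the raising generator. -/
def highest (D E : Module.End ℂ V) (m : ℂ) : Submodule ℂ V :=
  LinearMap.ker (D - m • 1) ⊓ LinearMap.ker E

theorem mem_highest {D E : Module.End ℂ V} {m : ℂ} {v : V} :
    v ∈ highest D E m ↔ D v = m • v ∧ E v = 0 := by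
  simp [highest, sub_eq_zero]

/-- The span of the vectors obtained from `X` by lowering. -/
def tower (F : Module.End ℂ V) (X : Submodule ℂ V) : Submodule ℂ V := ⨆ k : ℕ, X.map (F ^ k)

theorem pow_mem_tower (F : Module.End ℂ V) {X : Submodule ℂ V} {v : V} (hv : v ∈ X) (k : ℕ) :
    (F ^ k) v ∈ tower F X :=
  Submodule.mem_iSup_of_mem k (Submodule.mem_map_of_mem hv)

theorem le_tower (F : Module.End ℂ V) (X : Submodule ℂ V) : X ≤ tower F X :=
  fun _ hv => pow_mem_tower F hv 0

theorem tower_le {F : Module.End ℂ V} {X W : Submodule ℂ V}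
    (h : ∀ v ∈ X, ∀ k : ℕ, (F ^ k) v ∈ W) : tower F X ≤ W :=
  iSup_le fun k => Submodule.map_le_iff_le_comap.2 fun v hv => h v hv k

theorem pow_apply_mem {T : Module.End ℂ V} {W : Submodule ℂ V} (h : ∀ v ∈ W, T v ∈ W)
    (k : ℕ) {v : V} (hv : v ∈ W) : (T ^ k) v ∈ W := by
  induction k with
  | zero => exact hv
  | succ k ih => rw [pow_succ']; exact h _ ih

namespace IsRep

variable {q : ℝ} {L : ℕ} {D E F : Module.End ℂ V}

theorem eq_zero_of_lt (h : IsRep q L D E F) {m : ℤ} {v : V} (hv : D v = (m : ℂ) • v)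
    (hm : m < -L ∨ (L : ℤ) < m) : v = 0 := by
  by_contra h0
  obtain ⟨n, hn, h1⟩ := h.spectrum _ v h0 hv
  have h2 : m = L - 2 * n := by exact_mod_cast h1
  omega

theorem D_F_pow (h : IsRep q L D E F) {m : ℂ} {v : V} (hv : D v = m • v) (k : ℕ) :
    D ((F ^ k) v) = (m - 2 * k) • (F ^ k) v := by
  induction k with
  | zero => simp [hv]
  | succ k ih =>
    rw [pow_succ', Module.End.mul_apply, h.D_F, ih, map_smul]
    push_cast; module

theorem D_E_pow (h : IsRep q L D E F) {m : ℂ} {v : V} (hv : D v = m • v) (k : ℕ) :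
    D ((E ^ k) v) = (m + 2 * k) • (E ^ k) v := by
  induction k with
  | zero => simp [hv]
  | succ k ih =>
    rw [pow_succ', Module.End.mul_apply, h.D_E, ih, map_smul]
    push_cast; module

theorem E_F_pow (h : IsRep q L D E F) (hq : 0 < q) {m : ℤ} {v : V} (hv : D v = (m : ℂ) • v)
    (hE : E v = 0) (k : ℕ) :
    E ((F ^ (k + 1)) v) = ((qNum q (k + 1) * qNum q (m - k) : ℝ) : ℂ) • (F ^ k) v := by
  induction k with
  | zero =>
    have h1 : qNum q 1 = 1 := by
      have := qNum_add_one hq 0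
      rw [qNum_zero] at this
      simpa using this
    rw [zero_add, pow_one, h.E_F m v hv, hE]
    simp [h1]
  | succ k ih =>
    have hw : D ((F ^ (k + 1)) v) = ((m - 2 * (k + 1 : ℕ) : ℤ) : ℂ) • (F ^ (k + 1)) v := by
      rw [h.D_F_pow hv]; push_cast; rfl
    rw [pow_succ' F (k + 1), Module.End.mul_apply, h.E_F _ _ hw, ih, map_smul,
      ← Module.End.mul_apply F, ← pow_succ', ← add_smul]
    have := qNum_mul_qNum hq (k + 1) m
    congr 1
    rw [← Complex.ofReal_add]
    congr 1
    push_cast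
    rw [this]
    ring_nf

/-- There are no highest weight vectors of negative weight: lowering them would never give zero,
but there are only finitely many weights. -/
theorem eq_zero_of_neg (h : IsRep q L D E F) (hq : 0 < q) {m : ℤ} {v : V}
    (hv : D v = (m : ℂ) • v) (hE : E v = 0) (hm : m < 0) : v = 0 := by
  have h0 : ∀ k : ℕ, (F ^ k) v = 0 → v = 0 := by
    intro k
    induction k with
    | zero => intro hk; simpa using hk
    | succ k ih =>
      intro hk
      refine ih ?_
      have h1 := h.E_F_pow hq hv hE k
      rw [hk, map_zero, eq_comm, smul_eq_zero] at h1
      refine h1.resolve_left ?_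
      rw [Complex.ofReal_eq_zero]
      exact mul_ne_zero (qNum_ne_zero hq (by omega)) (qNum_ne_zero hq (by omega))
  refine h0 (L + 1) (h.eq_zero_of_lt (m := m - 2 * (L + 1 : ℕ)) ?_ (Or.inl ?_))
  · rw [h.D_F_pow hv]; push_cast; rfl
  · push_cast; omega

/-- Lowering a highest weight vector of weight `w` more than `w` times gives zero, because `w + 1`
times give a highest weight vector of negative weight. -/
theorem F_pow_eq_zero (h : IsRep q L D E F) (hq : 0 < q) {w : ℕ} {v : V}
    (hv : D v = (w : ℂ) • v) (hE : E v = 0) {k : ℕ} (hk : w < k) : (F ^ k) v = 0 := by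
  have h1 : (F ^ (w + 1)) v = 0 := by
    refine h.eq_zero_of_neg hq (m := w - 2 * (w + 1 : ℕ)) ?_ ?_ (by push_cast; omega)
    · rw [h.D_F_pow hv]; push_cast; rfl
    · rw [h.E_F_pow hq (m := w) (by simpa using hv) hE]
      simp [qNum_zero]
  obtain ⟨j, rfl⟩ : ∃ j, k = j + (w + 1) := ⟨k - (w + 1), by omega⟩
  rw [pow_add, Module.End.mul_apply, h1, map_zero]

theorem E_pow_F_pow (h : IsRep q L D E F) (hq : 0 < q) {w : ℕ} {v : V}
    (hv : D v = (w : ℂ) • v) (hE : E v = 0) {k : ℕ} (hk : k ≤ w) :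
    ∃ c : ℂ, c ≠ 0 ∧ (E ^ k) ((F ^ k) v) = c • v := by
  induction k with
  | zero => exact ⟨1, one_ne_zero, by simp⟩
  | succ k ih =>
    obtain ⟨c, hc, h1⟩ := ih (by omega)
    refine ⟨((qNum q (k + 1) * qNum q (w - k) : ℝ) : ℂ) * c, mul_ne_zero ?_ hc, ?_⟩
    · rw [Complex.ofReal_ne_zero]
      exact mul_ne_zero (qNum_ne_zero hq (by omega)) (qNum_ne_zero hq (by omega))
    · rw [pow_succ E, Module.End.mul_apply, h.E_F_pow hq (m := w) (by simpa using hv) hE,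
        map_smul, h1, smul_smul]

theorem E_pow_F_pow_of_lt (h : IsRep q L D E F) (hq : 0 < q) {w : ℕ} {v : V}
    (hv : D v = (w : ℂ) • v) (hE : E v = 0) {j k : ℕ} (hk : k < j) :
    (E ^ j) ((F ^ k) v) = 0 := by
  by_cases hkw : k ≤ w
  · obtain ⟨c, -, h1⟩ := h.E_pow_F_pow hq hv hE hkw
    obtain ⟨i, rfl⟩ : ∃ i, j = i + 1 + k := ⟨j - k - 1, by omega⟩
    rw [pow_add, Module.End.mul_apply, h1, map_smul, pow_succ, Module.End.mul_apply, hE, map_zero,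
      smul_zero]
  · rw [h.F_pow_eq_zero hq hv hE (by omega), map_zero]

/-- Every nonzero vector of the tower over `X` is raised into `X` without vanishing. -/
theorem exists_E_pow_mem (h : IsRep q L D E F) (hq : 0 < q) {w : ℕ} {X : Submodule ℂ V}
    (hX : X ≤ highest D E w) {v : V} (hv : v ∈ tower F X) (h0 : v ≠ 0) :
    ∃ k : ℕ, (E ^ k) v ∈ X ∧ (E ^ k) v ≠ 0 := by
  obtain ⟨f, hf, rfl⟩ := (Submodule.mem_iSup_iff_exists_finsupp _ _).1 hv
  have hne : f.support.Nonempty := by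
    rw [Finset.nonempty_iff_ne_empty]
    intro he
    simp [Finsupp.sum, he] at h0
  -- Raising as often as the most lowered summand was lowered kills all other summands.
  set k := f.support.max' hne with hk
  have hkm : k ∈ f.support := Finset.max'_mem _ _
  obtain ⟨x, hx, hfx⟩ := Submodule.mem_map.1 (hf k)
  have hx' := mem_highest.1 (hX hx)
  have hx0 : x ≠ 0 := by
    rintro rfl
    rw [map_zero] at hfx
    exact Finsupp.mem_support_iff.1 hkm hfx.symm
  have hkw : k ≤ w := by
    by_contra hlt
    rw [h.F_pow_eq_zero hq hx'.1 hx'.2 (by omega)] at hfx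
    exact Finsupp.mem_support_iff.1 hkm hfx.symm
  obtain ⟨c, hc, hcx⟩ := h.E_pow_F_pow hq hx'.1 hx'.2 hkw
  have hsum : (E ^ k) (f.sum fun _ x => x) = c • x := by
    rw [Finsupp.sum, map_sum, Finset.sum_eq_single_of_mem k hkm, ← hfx, hcx]
    intro j hj hjk
    obtain ⟨y, hy, hfy⟩ := Submodule.mem_map.1 (hf j)
    have hy' := mem_highest.1 (hX hy)
    rw [← hfy]
    exact h.E_pow_F_pow_of_lt hq hy'.1 hy'.2 (lt_of_le_of_ne (Finset.le_max' _ _ hj) hjk)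
  refine ⟨k, ?_, ?_⟩
  · rw [hsum]; exact X.smul_mem _ hx
  · rw [hsum]; exact smul_ne_zero hc hx0

theorem tower_F (F : Module.End ℂ V) (X : Submodule ℂ V) :
    ∀ v ∈ tower F X, F v ∈ tower F X := by
  have : tower F X ≤ (tower F X).comap F := tower_le fun v hv k => by
    rw [Submodule.mem_comap, ← Module.End.mul_apply, ← pow_succ']
    exact pow_mem_tower F hv _
  exact fun v hv => this hv

theorem tower_D (h : IsRep q L D E F) {m : ℂ} {X : Submodule ℂ V}
    (hX : X ≤ highest D E m) : ∀ v ∈ tower F X, D v ∈ tower F X := by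
  have : tower F X ≤ (tower F X).comap D := tower_le fun v hv k => by
    rw [Submodule.mem_comap, h.D_F_pow (mem_highest.1 (hX hv)).1]
    exact Submodule.smul_mem _ _ (pow_mem_tower F hv _)
  exact fun v hv => this hv

theorem tower_E (h : IsRep q L D E F) (hq : 0 < q) {m : ℤ} {X : Submodule ℂ V}
    (hX : X ≤ highest D E m) : ∀ v ∈ tower F X, E v ∈ tower F X := by
  have : tower F X ≤ (tower F X).comap E := tower_le fun v hv k => by
    have hv' := mem_highest.1 (hX hv)
    rw [Submodule.mem_comap]
    cases k with
    | zero => simp [hv'.2]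
    | succ k =>
      rw [h.E_F_pow hq hv'.1 hv'.2]
      exact Submodule.smul_mem _ _ (pow_mem_tower F hv _)
  exact fun v hv => this hv

theorem tower_span_le {φ : V} {W : Submodule ℂ V} (hφ : φ ∈ W) (hF : ∀ v ∈ W, F v ∈ W) :
    tower F (ℂ ∙ φ) ≤ W :=
  tower_le fun _ hv k =>
    pow_apply_mem hF k (((Submodule.span_singleton_le_iff_mem φ W).2 hφ) hv)

theorem tower_span_le_of_mem (h : IsRep q L D E F) (hq : 0 < q) {w : ℕ} {φ : V}
    (hφ : φ ∈ highest D E w) {U : Submodule ℂ V} (hU : U ≤ tower F (ℂ ∙ φ)) (h0 : U ≠ ⊥)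
    (hUE : ∀ v ∈ U, E v ∈ U) (hUF : ∀ v ∈ U, F v ∈ U) : tower F (ℂ ∙ φ) ≤ U := by
  obtain ⟨u, hu, hu0⟩ := (Submodule.ne_bot_iff U).1 h0
  obtain ⟨k, hk, hk0⟩ := h.exists_E_pow_mem hq
    ((Submodule.span_singleton_le_iff_mem _ _).2 hφ) (hU hu) hu0
  obtain ⟨c, hc⟩ := Submodule.mem_span_singleton.1 hk
  have hc0 : c ≠ 0 := by
    rintro rfl
    exact hk0 (by rw [← hc, zero_smul])
  have hku : (E ^ k) u ∈ U := pow_apply_mem hUE k hu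
  rw [← hc] at hku
  exact tower_span_le ((U.smul_mem_iff hc0).1 hku) hUF

theorem finrank_tower_span (h : IsRep q L D E F) (hq : 0 < q) {w : ℕ} {φ : V}
    (hφ : φ ∈ highest D E w) (h0 : φ ≠ 0) :
    Module.finrank ℂ (tower F (ℂ ∙ φ)) = w + 1 := by
  obtain ⟨hD, hE⟩ := mem_highest.1 hφ
  have hne : ∀ k : Fin (w + 1), (F ^ (k : ℕ)) φ ≠ 0 := by
    intro k hk
    obtain ⟨c, hc, h1⟩ := h.E_pow_F_pow hq hD hE (Nat.le_of_lt_succ k.2)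
    rw [hk, map_zero] at h1
    exact smul_ne_zero hc h0 h1.symm
  have hli : LinearIndependent ℂ fun k : Fin (w + 1) => (F ^ (k : ℕ)) φ := by
    refine Module.End.eigenvectors_linearIndependent' D (fun k : Fin (w + 1) => (w : ℂ) - 2 * k)
      ?_ _ fun k => ⟨Module.End.mem_eigenspace_iff.2 (h.D_F_pow hD k), hne k⟩
    intro i j hij
    have h2 : ((i : ℕ) : ℂ) = ((j : ℕ) : ℂ) := by
      have : (w : ℂ) - 2 * (i : ℕ) = w - 2 * (j : ℕ) := hij
      linear_combination (-1 / 2 : ℂ) * this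
    exact Fin.ext (by exact_mod_cast h2)
  have hspan : tower F (ℂ ∙ φ)
      = Submodule.span ℂ (Set.range fun k : Fin (w + 1) => (F ^ (k : ℕ)) φ) := by
    apply le_antisymm
    · refine tower_le fun v hv k => ?_
      obtain ⟨c, rfl⟩ := Submodule.mem_span_singleton.1 hv
      rw [map_smul]
      refine Submodule.smul_mem _ _ ?_
      by_cases hk : k < w + 1
      · exact Submodule.subset_span ⟨⟨k, hk⟩, rfl⟩
      · rw [h.F_pow_eq_zero hq hD hE (by omega)]
        exact Submodule.zero_mem _
    · rw [Submodule.span_le]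
      rintro _ ⟨k, rfl⟩
      exact pow_mem_tower F (Submodule.mem_span_singleton_self φ) k
  rw [hspan, finrank_span_eq_card hli, Fintype.card_fin]

/-- A nonzero subrepresentation contains a highest weight vector. -/
theorem exists_highest [FiniteDimensional ℂ V] (h : IsRep q L D E F) (hq : 0 < q)
    {W : Submodule ℂ V} (h0 : W ≠ ⊥) (hWD : ∀ v ∈ W, D v ∈ W) (hWE : ∀ v ∈ W, E v ∈ W) :
    ∃ n : ℕ, 2 * n ≤ L ∧ ∃ φ ∈ W, φ ≠ 0 ∧ φ ∈ highest D E (L - 2 * n) := by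
  have : Nontrivial W := Submodule.nontrivial_iff_ne_bot.2 h0
  obtain ⟨μ, hμ⟩ := Module.End.exists_eigenvalue (D.restrict hWD)
  obtain ⟨v, hv⟩ := hμ.exists_hasEigenvector
  have hv1 : D v = μ • (v : V) := congrArg Subtype.val hv.apply_eq_smul
  have hv0 : (v : V) ≠ 0 := fun h1 => hv.2 (Subtype.ext h1)
  have hex : ∃ k : ℕ, (E ^ k) (v : V) = 0 := by
    obtain ⟨n, hn, hm⟩ := h.spectrum _ _ hv0 hv1
    refine ⟨n + 1, h.eq_zero_of_lt (m := (L : ℤ) - 2 * n + 2 * (n + 1 : ℕ)) ?_ (Or.inr ?_)⟩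
    · rw [h.D_E_pow hv1, hm]; push_cast; rfl
    · push_cast; omega
  classical
  have hspec := Nat.find_spec hex
  have hpos : Nat.find hex ≠ 0 := by
    intro hz; rw [hz] at hspec; exact hv0 (by simpa using hspec)
  obtain ⟨j, hj⟩ := Nat.exists_eq_succ_of_ne_zero hpos
  have hφ0 : (E ^ j) (v : V) ≠ 0 := Nat.find_min hex (by omega)
  have hE : E ((E ^ j) (v : V)) = 0 := by
    rw [← Module.End.mul_apply, ← pow_succ', ← Nat.succ_eq_add_one, ← hj]; exact hspec
  have hD := h.D_E_pow hv1 j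
  obtain ⟨n, hn, hm⟩ := h.spectrum _ _ hφ0 hD
  rw [hm] at hD
  refine ⟨n, ?_, _, pow_apply_mem hWE j v.2, hφ0, mem_highest.2 ⟨hD, hE⟩⟩
  by_contra hlt
  refine hφ0 (h.eq_zero_of_neg hq (m := (L : ℤ) - 2 * n) ?_ hE (by omega))
  rw [hD]; push_cast; rfl

end IsRep

/-! ### From the infinite chain to finite chains -/

open scoped Matrix

/-- A configuration of `L` sites, continued by up spins. -/
def extend {L : ℕ} (σ : Config L) : ℕ → Fin 2 := fun y => if h : y < L then σ ⟨y, h⟩ else 0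

theorem extend_of_lt {L : ℕ} (σ : Config L) {y : ℕ} (h : y < L) : extend σ y = σ ⟨y, h⟩ :=
  dif_pos h

@[simp] theorem extend_val {L : ℕ} (σ : Config L) (x : Fin L) : extend σ x = σ x := by
  simp [extend]

theorem extend_update {L : ℕ} (σ : Config L) (x : Fin L) (a : Fin 2) :
    extend (Function.update σ x a) = Function.update (extend σ) x a := by
  funext y
  by_cases h : y < L
  · by_cases hy : y = x
    · subst hy; simp
    · have : (⟨y, h⟩ : Fin L) ≠ x := fun h1 => hy (by rw [← h1])
      simp [extend, h, this, hy]
  · have : y ≠ x := fun h1 => h (h1 ▸ x.2)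
    simp [extend, h, this]

/-- The components of a vector of the infinite chain with all spins up from site `L` on. -/
def res (L : ℕ) : Chain →ₗ[ℂ] Space L where
  toFun f := WithLp.toLp 2 fun σ => f (extend σ)
  map_add' _ _ := rfl
  map_smul' _ _ := rfl

theorem res_apply (L : ℕ) (f : Chain) (σ : Config L) : res L f σ = f (extend σ) := rfl

/-- The vector `ψ ⊗ up ⊗ up ⊗ ⋯` of the infinite chain. -/
def emb (L : ℕ) (ψ : Space L) : Chain := by
  classical exact fun σ => if ∀ y, L ≤ y → σ y = 0 then ψ fun i => σ i else 0

theorem res_emb {L : ℕ} (ψ : Space L) : res L (emb L ψ) = ψ := by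
  ext σ
  have h : ∀ y, L ≤ y → extend σ y = 0 := fun y hy => by simp [extend, hy.not_gt]
  simp [res_apply, emb, if_pos h]

theorem weight_eq_sum (L : ℕ) (σ : ℕ → Fin 2) :
    weight L σ = ∑ y ∈ Finset.range L, twoSpin (σ y) := by
  induction L generalizing σ with
  | zero => rfl
  | succ L ih => rw [Finset.sum_range_succ', weight, ih, add_comm]; rfl

theorem raise_apply {q : ℂ} (hq : q ≠ 0) (L : ℕ) (f : Chain) (σ : ℕ → Fin 2) :
    raise q L f σ = ∑ x ∈ Finset.range L,
      if σ x = 0 then q ^ weight x σ * f (Function.update σ x 1) else 0 := by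
  induction L generalizing f σ with
  | zero => simp [raise]
  | succ L ih =>
    obtain ⟨c, τ, rfl⟩ : ∃ c τ, σ = push c τ := ⟨σ 0, tail σ, (push_tail σ).symm⟩
    change slice c (raise q (L + 1) f) τ = _
    rw [Finset.sum_range_succ']
    have hc : c = 0 ∨ c = 1 := Fin.exists_fin_two.1 ⟨c, rfl⟩
    rcases hc with rfl | rfl
    · rw [slice_zero_raise]
      simp [ih, slice_apply, weight, update_push_zero, update_push_succ,
        twoSpin, zpow_add₀ hq, Finset.mul_sum, mul_assoc]
    · rw [slice_one_raise]
      simp [ih, slice_apply, weight, update_push_succ,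
        twoSpin, zpow_add₀ hq, Finset.mul_sum, mul_assoc]

theorem lower_apply (q : ℂ) (L : ℕ) (f : Chain) (σ : ℕ → Fin 2) :
    lower q L f σ = ∑ x ∈ Finset.range L,
      if σ x = 1 then q ^ (-(weight L σ - weight (x + 1) σ)) * f (Function.update σ x 0)
      else 0 := by
  induction L generalizing f σ with
  | zero => simp [lower]
  | succ L ih =>
    obtain ⟨c, τ, rfl⟩ : ∃ c τ, σ = push c τ := ⟨σ 0, tail σ, (push_tail σ).symm⟩
    change slice c (lower q (L + 1) f) τ = _
    rw [Finset.sum_range_succ']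
    have hc : c = 0 ∨ c = 1 := Fin.exists_fin_two.1 ⟨c, rfl⟩
    rcases hc with rfl | rfl
    · rw [slice_zero_lower]
      simp [ih, slice_apply, weight, update_push_succ]
    · rw [slice_one_lower]
      simp [ih, slice_apply, weight, update_push_zero, update_push_succ,
        mulWeight_apply]

theorem hop_apply_apply (q : ℂ) (x : ℕ) (f : Chain) (σ : ℕ → Fin 2) :
    hop q x f σ = (1 + q ^ 2)⁻¹ *
      ((if σ x = 0 ∧ σ (x + 1) = 1 then 1 else if σ x = 1 ∧ σ (x + 1) = 0 then -q else 0) *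
      (f (Function.update (Function.update σ x 0) (x + 1) 1)
        - q * f (Function.update (Function.update σ x 1) (x + 1) 0))) := by
  suffices h : cup q x (cap q x f) σ =
      (if σ x = 0 ∧ σ (x + 1) = 1 then 1 else if σ x = 1 ∧ σ (x + 1) = 0 then -q else 0) *
      (f (Function.update (Function.update σ x 0) (x + 1) 1)
        - q * f (Function.update (Function.update σ x 1) (x + 1) 0)) by
    rw [← h]; rfl
  induction x generalizing f σ with
  | zero =>
    obtain ⟨c, τ, rfl⟩ : ∃ c τ, σ = push c τ := ⟨σ 0, tail σ, (push_tail σ).symm⟩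
    obtain ⟨d, τ, rfl⟩ : ∃ c σ, τ = push c σ := ⟨τ 0, tail τ, (push_tail τ).symm⟩
    change slice d (slice c (cup q 0 (cap q 0 f))) τ = _
    have hc : c = 0 ∨ c = 1 := Fin.exists_fin_two.1 ⟨c, rfl⟩
    rcases hc with rfl | rfl
    · rw [slice_zero_cup_zero, slice_glue]
      by_cases hd : d = 1 <;>
      simp [hd, update_push_zero, update_push_succ, cap_zero_apply, slice_apply]
    · rw [slice_one_cup_zero, map_neg, map_smul, slice_glue]
      by_cases hd : d = 0 <;>
      simp [hd, update_push_zero, update_push_succ, cap_zero_apply, slice_apply]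
  | succ x ih =>
    obtain ⟨c, τ, rfl⟩ : ∃ c τ, σ = push c τ := ⟨σ 0, tail σ, (push_tail σ).symm⟩
    change slice c (cup q (x + 1) (cap q (x + 1) f)) τ = _
    rw [slice_cup_succ, slice_cap_succ, ih]
    simp only [update_push_succ, slice_apply, push_succ]
    congr

theorem site_mulVec {L : ℕ} (x : Fin L) (A : Matrix (Fin 2) (Fin 2) ℂ) (g : Config L → ℂ)
    (σ : Config L) :
    (site x A *ᵥ g) σ = ∑ a, A (σ x) a * g (Function.update σ x a) := by
  symm
  refine Fintype.sum_of_injective (fun a => Function.update σ x a)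
    (Function.update_injective σ x) _ _ (fun τ hτ => ?_) fun a => ?_
  · have : ¬ ∀ y, y ≠ x → σ y = τ y := fun h => hτ ⟨τ x, by
      funext y
      by_cases hy : y = x
      · subst hy; simp
      · simp [hy, h y hy]⟩
    simp [site, this]
  · have : ∀ y, y ≠ x → σ y = Function.update σ x a y := fun y hy => by simp [hy]
    simp only [site, Matrix.of_apply, if_pos this, Function.update_self]

theorem sPlus_eq : SPlus = !![0, 1; 0, 0] := by
  ext i j
  fin_cases i <;> fin_cases j <;> simp [SPlus, S1, S2] <;> ring_nf <;> simp; norm_num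

theorem sMinus_eq : SMinus = !![0, 0; 1, 0] := by
  ext i j
  fin_cases i <;> fin_cases j <;> simp [SMinus, S1, S2] <;> ring_nf <;> simp; norm_num

theorem qPow_mulVec (q : ℝ) {L : ℕ} (A : Finset (Fin L)) (g : Config L → ℂ) (σ : Config L) :
    (qPow q A *ᵥ g) σ = (q : ℂ) ^ (∑ y ∈ A, twoSpin (σ y)) * g σ := by
  simp [qPow, Matrix.mulVec_diagonal]

theorem sum_Iio_twoSpin {L : ℕ} (σ : Config L) (x : Fin L) :
    ∑ y ∈ Finset.Iio x, twoSpin (σ y) = weight x (extend σ) := by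
  rw [weight_eq_sum, ← Nat.Iio_eq_range, ← Fin.map_valEmbedding_Iio, Finset.sum_map]
  simp

theorem sum_univ_twoSpin {L : ℕ} (σ : Config L) :
    ∑ y, twoSpin (σ y) = weight L (extend σ) := by
  rw [weight_eq_sum, ← Fin.sum_univ_eq_sum_range fun y => twoSpin (extend σ y)]
  simp

theorem sum_Ioi_twoSpin {L : ℕ} (σ : Config L) (x : Fin L) :
    ∑ y ∈ Finset.Ioi x, twoSpin (σ y) = weight L (extend σ) - weight (x + 1) (extend σ) := by
  have h : weight (x + 1) (extend σ) = ∑ y ∈ Finset.Iic x, twoSpin (σ y) := by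
    rw [weight_eq_sum, Nat.range_succ_eq_Iic, ← Fin.map_valEmbedding_Iic, Finset.sum_map]
    simp
  rw [h, ← sum_univ_twoSpin, eq_sub_iff_add_eq, ← Finset.sum_union]
  · congr 1
    ext y
    simp [lt_or_ge]
  · rw [Finset.disjoint_left]
    intro y; simp

theorem toEuclideanLin_res {L : ℕ} (M : Op L) (f : Chain) (σ : Config L) :
    Matrix.toEuclideanLin M (res L f) σ = (M *ᵥ fun τ => f (extend τ)) σ := rfl

theorem total3_res (L : ℕ) (f : Chain) :
    ((2 : ℂ) • Matrix.toEuclideanLin (total3 L)) (res L f) = res L (mulWeight (fun w => w) L f) := by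
  ext σ
  rw [LinearMap.smul_apply, PiLp.smul_apply, toEuclideanLin_res, res_apply, mulWeight_apply,
    ← sum_univ_twoSpin, total3, Matrix.sum_mulVec, Finset.sum_apply]
  simp only [site_mulVec, Int.cast_sum, Finset.sum_mul, smul_eq_mul, Finset.mul_sum]
  refine Finset.sum_congr rfl fun x _ => ?_
  have hu := Function.update_eq_self x σ
  rcases Fin.exists_fin_two.1 ⟨σ x, rfl⟩ with h | h <;> rw [h] at hu <;>
  simp [S3, h, twoSpin, hu]; ring

theorem totalPlus_res {q : ℝ} (hq : 0 < q) (L : ℕ) (f : Chain) :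
    Matrix.toEuclideanLin (totalPlus q L) (res L f) = res L (raise q L f) := by
  ext σ
  rw [toEuclideanLin_res, res_apply, raise_apply (by exact_mod_cast hq.ne'), totalPlus,
    Matrix.sum_mulVec, Finset.sum_apply, ← Fin.sum_univ_eq_sum_range
      fun x => if extend σ x = 0 then (q : ℂ) ^ weight x (extend σ) *
        f (Function.update (extend σ) x 1) else 0]
  refine Finset.sum_congr rfl fun x _ => ?_
  rw [← Matrix.mulVec_mulVec, qPow_mulVec, site_mulVec, sum_Iio_twoSpin, extend_val, sPlus_eq]
  rcases Fin.exists_fin_two.1 ⟨σ x, rfl⟩ with h | h <;> simp [h, extend_update]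

theorem totalMinus_res {q : ℝ} (L : ℕ) (f : Chain) :
    Matrix.toEuclideanLin (totalMinus q L) (res L f) = res L (lower q L f) := by
  ext σ
  rw [toEuclideanLin_res, res_apply, lower_apply, totalMinus,
    Matrix.sum_mulVec, Finset.sum_apply, ← Fin.sum_univ_eq_sum_range
      fun x => if extend σ x = 1 then (q : ℂ) ^ (-(weight L (extend σ) -
        weight (x + 1) (extend σ))) * f (Function.update (extend σ) x 0) else 0]
  refine Finset.sum_congr rfl fun x _ => ?_
  rw [← Matrix.mulVec_mulVec, qPow_mulVec, site_mulVec, sum_Ioi_twoSpin, extend_val, sMinus_eq,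
    Complex.ofReal_inv, inv_zpow']
  rcases Fin.exists_fin_two.1 ⟨σ x, rfl⟩ with h | h <;> simp [h, extend_update]

theorem bond_mulVec {Δ q : ℝ} (hq : 0 < q) (hq1 : q ≤ 1) (hΔ : Δ = (q + q⁻¹) / 2) {L : ℕ}
    {x y : Fin L} (hxy : x ≠ y) (g : Config L → ℂ) (σ : Config L) :
    (bond Δ x y *ᵥ g) σ = (1 + (q : ℂ) ^ 2)⁻¹ *
      ((if σ x = 0 ∧ σ y = 1 then 1 else if σ x = 1 ∧ σ y = 0 then -(q : ℂ) else 0) *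
      (g (Function.update (Function.update σ x 0) y 1)
        - q * g (Function.update (Function.update σ x 1) y 0))) := by
  have h1 : Δ⁻¹ = 2 * q / (1 + q ^ 2) := by
    rw [hΔ]; field_simp; ring
  have h2 : √(1 - (Δ ^ 2)⁻¹) = (1 - q ^ 2) / (1 + q ^ 2) := by
    have h3 : 1 - (Δ ^ 2)⁻¹ = ((1 - q ^ 2) / (1 + q ^ 2)) ^ 2 := by
      rw [← inv_pow, h1]; field_simp; ring
    rw [h3, Real.sqrt_sq]
    have : q ^ 2 ≤ 1 := by nlinarith
    exact div_nonneg (by linarith) (by positivity)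
  have hne : (1 + (q : ℂ) ^ 2) ≠ 0 := by
    have : (1 + q ^ 2 : ℝ) ≠ 0 := by positivity
    exact_mod_cast this
  have hyx := hxy.symm
  rw [bond, h1, h2]
  simp only [Matrix.add_mulVec, Matrix.sub_mulVec, Matrix.smul_mulVec, ← Matrix.mulVec_mulVec,
    Pi.add_apply, Pi.sub_apply, Pi.smul_apply, site_mulVec, Matrix.one_mulVec,
    Function.update_of_ne hyx, Fin.sum_univ_two, smul_eq_mul]
  have hux := Function.update_eq_self x σ
  have huy := Function.update_eq_self y σ
  rcases Fin.exists_fin_two.1 ⟨σ x, rfl⟩ with hx | hx <;>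
  rcases Fin.exists_fin_two.1 ⟨σ y, rfl⟩ with hy | hy <;>
  rw [hx] at hux <;> rw [hy] at huy <;>
  simp [S1, S2, S3, hx, hy, hux, huy] <;> ring_nf <;> simp <;> field_simp <;> ring

/-- The Hamiltonian of the first `L` sites. -/
def energy (q : ℂ) (L : ℕ) : Module.End ℂ Chain := ∑ x ∈ Finset.range (L - 1), hop q x

theorem hamiltonian_res {Δ q : ℝ} (hq : 0 < q) (hq1 : q ≤ 1) (hΔ : Δ = (q + q⁻¹) / 2) (L : ℕ)
    (f : Chain) :
    Matrix.toEuclideanLin (hamiltonian Δ L) (res L f) = res L (energy q L f) := by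
  ext σ
  rw [toEuclideanLin_res, res_apply, energy, LinearMap.sum_apply, Finset.sum_apply, hamiltonian]
  cases L with
  | zero => simp
  | succ M =>
    rw [Matrix.sum_mulVec, Finset.sum_apply, Fin.sum_univ_castSucc, Nat.add_sub_cancel,
      ← Fin.sum_univ_eq_sum_range fun x => hop (q : ℂ) x f (extend σ)]
    have hlast : (∑ y : Fin (M + 1), if (Fin.last M : ℕ) + 1 = (y : ℕ) then
        bond Δ (Fin.last M) y else 0) = 0 :=
      Finset.sum_eq_zero fun y _ => if_neg (by have := y.2; simp only [Fin.val_last]; omega)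
    rw [hlast, Matrix.zero_mulVec, Pi.zero_apply, add_zero]
    refine Finset.sum_congr rfl fun x _ => ?_
    rw [Finset.sum_eq_single x.succ (fun y _ hy => if_neg fun h => hy (Fin.ext (by simp [← h])))
      (by simp), if_pos (by simp), bond_mulVec hq hq1 hΔ (Fin.castSucc_lt_succ).ne,
      hop_apply_apply]
    have h1 : extend σ x = σ x.castSucc := extend_val σ x.castSucc
    have h2 : extend σ (x + 1) = σ x.succ := extend_val σ x.succ
    simp only [extend_update, h1, h2]
    rfl

theorem site_isHermitian {L : ℕ} (x : Fin L) {A : Matrix (Fin 2) (Fin 2) ℂ} (hA : A.IsHermitian) :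
    (site x A).IsHermitian := by
  ext σ τ
  by_cases h : ∀ y, y ≠ x → σ y = τ y
  · have h' : ∀ y, y ≠ x → τ y = σ y := fun y hy => (h y hy).symm
    simp only [Matrix.conjTranspose_apply, site, Matrix.of_apply, if_pos h, if_pos h']
    exact hA.apply _ _
  · have h' : ¬ ∀ y, y ≠ x → τ y = σ y := fun h1 => h fun y hy => (h1 y hy).symm
    simp only [Matrix.conjTranspose_apply, site, Matrix.of_apply, if_neg h, if_neg h', star_zero]

theorem site_commute {L : ℕ} {x y : Fin L} (h : x ≠ y) (A B : Matrix (Fin 2) (Fin 2) ℂ) :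
    Commute (site x A) (site y B) := by
  refine Matrix.ext_iff_mulVec.2 fun g => ?_
  funext σ
  simp only [← Matrix.mulVec_mulVec, site_mulVec, Function.update_of_ne h,
    Function.update_of_ne h.symm, Finset.mul_sum]
  rw [Finset.sum_comm]
  refine Finset.sum_congr rfl fun a _ => Finset.sum_congr rfl fun b _ => ?_
  rw [Function.update_comm h]
  ring

theorem s1_isHermitian : S1.IsHermitian := by
  ext i j; fin_cases i <;> fin_cases j <;> simp [S1]

theorem s2_isHermitian : S2.IsHermitian := by
  ext i j; fin_cases i <;> fin_cases j <;> simp [S2]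

theorem s3_isHermitian : S3.IsHermitian := by
  ext i j; fin_cases i <;> fin_cases j <;> simp [S3]

theorem bond_isHermitian (Δ : ℝ) {L : ℕ} {x y : Fin L} (h : x ≠ y) :
    (bond Δ x y).IsHermitian := by
  have hr : ∀ (r : ℝ) {M : Op L}, M.IsHermitian → ((r : ℂ) • M).IsHermitian := by
    intro r M hM
    rw [Matrix.IsHermitian, Matrix.conjTranspose_smul, hM]
    simp
  have hp : ∀ {A : Matrix (Fin 2) (Fin 2) ℂ}, A.IsHermitian →
      (site x A * site y A).IsHermitian := fun hA =>
    ((site_isHermitian x hA).commute_iff (site_isHermitian y hA)).1 (site_commute h _ _)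
  have h1 : ((1 / 4 : ℂ) • (1 : Op L)).IsHermitian := by
    have := hr (1 / 4) (Matrix.isHermitian_one (n := Config L))
    simpa using this
  unfold bond
  exact ((h1.sub (hp s3_isHermitian)).sub (hr _ ((hp s1_isHermitian).add (hp s2_isHermitian)))).add
    (hr _ ((site_isHermitian x s3_isHermitian).sub (site_isHermitian y s3_isHermitian)))

theorem hamiltonian_isHermitian (Δ : ℝ) (L : ℕ) : (hamiltonian Δ L).IsHermitian := by
  rw [Matrix.IsHermitian, hamiltonian, Matrix.conjTranspose_sum]
  refine Finset.sum_congr rfl fun x _ => ?_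
  rw [Matrix.conjTranspose_sum]
  refine Finset.sum_congr rfl fun y _ => ?_
  split_ifs with h
  · exact bond_isHermitian Δ fun hxy => by rw [hxy] at h; omega
  · simp

theorem exists_weight_eq (L : ℕ) (σ : ℕ → Fin 2) :
    ∃ n : ℕ, n ≤ L ∧ weight L σ = L - 2 * n := by
  induction L generalizing σ with
  | zero => exact ⟨0, le_rfl, by simp [weight]⟩
  | succ L ih =>
    obtain ⟨n, hn, h⟩ := ih (tail σ)
    rw [weight, h, twoSpin]
    split_ifs
    · exact ⟨n, by omega, by push_cast; ring⟩
    · exact ⟨n + 1, by omega, by push_cast; ring⟩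

/-- Twice the third generator, as an operator. -/
def opD (L : ℕ) : Module.End ℂ (Space L) := (2 : ℂ) • Matrix.toEuclideanLin (total3 L)

/-- The raising generator, as an operator. -/
def opE (q : ℝ) (L : ℕ) : Module.End ℂ (Space L) := Matrix.toEuclideanLin (totalPlus q L)

/-- The lowering generator, as an operator. -/
def opF (q : ℝ) (L : ℕ) : Module.End ℂ (Space L) := Matrix.toEuclideanLin (totalMinus q L)

/-- The Hamiltonian, as an operator. -/
def opH (Δ : ℝ) (L : ℕ) : Module.End ℂ (Space L) := Matrix.toEuclideanLin (hamiltonian Δ L)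

theorem opD_res (L : ℕ) (f : Chain) : opD L (res L f) = res L (mulWeight (fun w => w) L f) :=
  total3_res L f

theorem opE_res {q : ℝ} (hq : 0 < q) (L : ℕ) (f : Chain) :
    opE q L (res L f) = res L (raise q L f) := totalPlus_res hq L f

theorem opF_res (q : ℝ) (L : ℕ) (f : Chain) : opF q L (res L f) = res L (lower q L f) :=
  totalMinus_res L f

theorem weight_spectrum {L : ℕ} {μ : ℂ} {σ : ℕ → Fin 2} {z : ℂ} (hz : z ≠ 0)
    (h : (weight L σ : ℂ) * z = μ * z) : ∃ n : ℕ, n ≤ L ∧ μ = L - 2 * n := by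
  obtain ⟨n, hn, hw⟩ := exists_weight_eq L σ
  refine ⟨n, hn, ?_⟩
  rw [← mul_right_cancel₀ hz h, hw]
  push_cast; rfl

theorem qNum_recurrence {q : ℝ} (hq : 0 < q) (w : ℤ) :
    (qNum q (w + 1) : ℂ) = (q : ℂ) * (qNum q w : ℂ) + (q : ℂ) ^ (-w) := by
  rw [qNum_add_one hq]; push_cast; rfl

theorem mulWeight_two (L : ℕ) (f : Chain) : mulWeight (fun _ => 2) L f = (2 : ℂ) • f := by
  funext σ; rfl

theorem isRep_chain {q : ℝ} (hq : 0 < q) (L : ℕ) :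
    IsRep q L (mulWeight (fun w => w) L) (raise q L) (lower q L) where
  D_E v := by
    rw [raise_mulWeight, ← mulWeight_two, ← mulWeight_add]; simp
  D_F v := by
    rw [lower_mulWeight, ← mulWeight_two, sub_eq_add_neg, ← neg_one_smul ℂ, ← mulWeight_smul,
      ← mulWeight_add]; simp
  E_F m v hv := by
    rw [raise_lower (by exact_mod_cast hq.ne') (g := fun w => (qNum q w : ℂ))
      (by simp [qNum_zero]) (qNum_recurrence hq)]
    congr 1
    funext σ
    have h := congrFun hv σ
    simp only [mulWeight_apply, Pi.smul_apply, smul_eq_mul] at h ⊢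
    rcases eq_or_ne (v σ) 0 with h0 | h0
    · simp [h0]
    · have h1 : weight L σ = m := by exact_mod_cast mul_right_cancel₀ h0 h
      rw [h1]
  spectrum μ v h0 hv := by
    obtain ⟨σ, hσ⟩ := Function.ne_iff.1 h0
    exact weight_spectrum hσ (congrFun hv σ)

theorem isRep_space {q : ℝ} (hq : 0 < q) (L : ℕ) :
    IsRep q L (opD L) (opE q L) (opF q L) where
  D_E v := by
    rw [← res_emb v]
    simp only [opD_res, opE_res hq, (isRep_chain hq L).D_E, map_add, map_smul]
  D_F v := by
    rw [← res_emb v]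
    simp only [opD_res, opF_res, (isRep_chain hq L).D_F, map_sub, map_smul]
  E_F m v hv := by
    rw [← res_emb v] at hv ⊢
    simp only [opF_res, opE_res hq]
    rw [raise_lower (by exact_mod_cast hq.ne') (g := fun w => (qNum q w : ℂ))
      (by simp [qNum_zero]) (qNum_recurrence hq), map_add]
    congr 1
    ext σ
    have h := congrArg (fun ψ : Space L => ψ σ) (((opD_res L _).symm.trans hv))
    simp only [res_apply, mulWeight_apply, PiLp.smul_apply, smul_eq_mul] at h ⊢
    rcases eq_or_ne (emb L v (extend σ)) 0 with h0 | h0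
    · simp [h0]
    · have h1 : weight L (extend σ) = m := by exact_mod_cast mul_right_cancel₀ h0 h
      rw [h1]
  spectrum μ v h0 hv := by
    rw [← res_emb v] at hv h0
    obtain ⟨σ, hσ⟩ : ∃ σ, res L (emb L v) σ ≠ 0 := by
      by_contra! hc
      exact h0 (by ext σ; exact hc σ)
    exact weight_spectrum hσ
      (congrArg (fun ψ : Space L => ψ σ) ((opD_res L _).symm.trans hv))

theorem opH_isSymmetric (Δ : ℝ) (L : ℕ) : (opH Δ L).IsSymmetric :=
  Matrix.isSymmetric_toEuclideanLin_iff.2 (hamiltonian_isHermitian Δ L)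

theorem energy_apply (q : ℂ) (L : ℕ) (f : Chain) :
    energy q L f = ∑ x ∈ Finset.range (L - 1), hop q x f := by
  simp [energy]

theorem raise_energy {q : ℂ} (hq : q ≠ 0) (L : ℕ) (f : Chain) :
    raise q L (energy q L f) = energy q L (raise q L f) := by
  simp only [energy_apply, map_sum]
  refine Finset.sum_congr rfl fun x hx => raise_hop hq ?_ f
  have := Finset.mem_range.1 hx; omega

theorem lower_energy {q : ℂ} (hq : q ≠ 0) (L : ℕ) (f : Chain) :
    lower q L (energy q L f) = energy q L (lower q L f) := by
  simp only [energy_apply, map_sum]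
  refine Finset.sum_congr rfl fun x hx => lower_hop hq ?_ f
  have := Finset.mem_range.1 hx; omega

theorem mulWeight_energy (q : ℂ) (u : ℤ → ℂ) (L : ℕ) (f : Chain) :
    mulWeight u L (energy q L f) = energy q L (mulWeight u L f) := by
  simp only [energy_apply, map_sum]
  refine Finset.sum_congr rfl fun x hx => mulWeight_hop q u ?_ f
  have := Finset.mem_range.1 hx; omega

theorem opH_res {Δ q : ℝ} (hq : 0 < q) (hq1 : q ≤ 1) (hΔ : Δ = (q + q⁻¹) / 2) (L : ℕ)
    (f : Chain) : opH Δ L (res L f) = res L (energy q L f) :=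
  hamiltonian_res hq hq1 hΔ L f

theorem opD_opH {Δ q : ℝ} (hq : 0 < q) (hq1 : q ≤ 1) (hΔ : Δ = (q + q⁻¹) / 2) {L : ℕ}
    (v : Space L) : opD L (opH Δ L v) = opH Δ L (opD L v) := by
  rw [← res_emb v]
  simp only [opH_res hq hq1 hΔ, opD_res, mulWeight_energy]

theorem opE_opH {Δ q : ℝ} (hq : 0 < q) (hq1 : q ≤ 1) (hΔ : Δ = (q + q⁻¹) / 2) {L : ℕ}
    (v : Space L) : opE q L (opH Δ L v) = opH Δ L (opE q L v) := by
  rw [← res_emb v]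
  have hq' : (q : ℂ) ≠ 0 := by exact_mod_cast hq.ne'
  simp only [opH_res hq hq1 hΔ, opE_res hq, raise_energy hq']

theorem opF_opH {Δ q : ℝ} (hq : 0 < q) (hq1 : q ≤ 1) (hΔ : Δ = (q + q⁻¹) / 2) {L : ℕ}
    (v : Space L) : opF q L (opH Δ L v) = opH Δ L (opF q L v) := by
  rw [← res_emb v]
  have hq' : (q : ℂ) ≠ 0 := by exact_mod_cast hq.ne'
  simp only [opH_res hq hq1 hΔ, opF_res, lower_energy hq']

/-! ### Diagrams and their cone -/

open scoped NNReal

/-- The vector with all spins up. -/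
def vac : Chain := by
  classical exact fun σ => if ∀ y, σ y = 0 then 1 else 0

theorem slice_zero_vac : slice 0 vac = vac := by
  funext σ
  have h : (∀ y, push 0 σ y = 0) ↔ ∀ y, σ y = 0 :=
    ⟨fun h y => h (y + 1), fun h y => by cases y <;> simp [h]⟩
  by_cases hσ : ∀ y, σ y = 0
  · simp only [slice_apply, vac, if_pos (h.2 hσ), if_pos hσ]
  · simp only [slice_apply, vac, if_neg hσ, if_neg fun h1 => hσ (h.1 h1)]

theorem slice_one_vac : slice 1 vac = 0 := by
  funext σ
  have h : ¬ ∀ y, push 1 σ y = 0 := fun h => by simpa using h 0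
  simp [slice_apply, vac, h]

theorem glue_zero_vac : glue 0 vac = vac := by
  apply chain_ext
  · rw [slice_glue_same, slice_zero_vac]
  · rw [slice_one_glue_zero, slice_one_vac]

theorem raise_vac (q : ℂ) (L : ℕ) : raise q L vac = 0 := by
  induction L with
  | zero => rfl
  | succ L ih =>
    apply chain_ext <;>
    simp [slice_zero_raise, slice_one_raise, slice_zero_vac, slice_one_vac, ih]

theorem mulWeight_vac (u : ℤ → ℂ) (L : ℕ) : mulWeight u L vac = u L • vac := by
  induction L generalizing u with
  | zero => funext σ; simp [mulWeight_apply, weight]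
  | succ L ih =>
    apply chain_ext <;>
    simp [slice_zero_mulWeight, slice_one_mulWeight, slice_zero_vac, slice_one_vac, ih]

theorem cap_vac (q : ℂ) (x : ℕ) : cap q x vac = 0 := by
  induction x with
  | zero => simp [cap_zero_apply, slice_zero_vac, slice_one_vac]
  | succ x ih => apply chain_ext <;> simp [slice_zero_vac, slice_one_vac, ih]

theorem hop_vac (q : ℂ) (x : ℕ) : hop q x vac = 0 := by
  rw [hop_apply, cap_vac]; simp

/-- The Temperley–Lieb diagram vectors with `n` arcs on the first `L` sites: noncrossing arcs
carry `q`-singlets, and the remaining sites, none of them below an arc, carry up spins. Such a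
diagram arises from the empty one by inserting arcs between neighbouring new sites. -/
def diag (q : ℝ) : ℕ → ℕ → Set Chain
  | 0, _ => {vac}
  | n + 1, L => {d | ∃ x, x + 2 ≤ L ∧ ∃ a ∈ diag q n (L - 2), d = cup q x a}

theorem cup_mem_diag {q : ℝ} {n L x : ℕ} (hx : x ≤ L) {a : Chain} (ha : a ∈ diag q n L) :
    cup q x a ∈ diag q (n + 1) (L + 2) :=
  ⟨x, by omega, a, by simpa using ha, rfl⟩

theorem exists_of_mem_diag {q : ℝ} {n L : ℕ} {d : Chain} (hd : d ∈ diag q (n + 1) L) :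
    ∃ M x, L = M + 2 ∧ x ≤ M ∧ ∃ a ∈ diag q n M, d = cup q x a := by
  obtain ⟨x, hx, a, ha, rfl⟩ := hd
  exact ⟨L - 2, x, by omega, by omega, a, ha, rfl⟩

/-- A diagram on `L` sites is also a diagram on `L + 1` sites, the last of them unpaired. -/
theorem diag_subset_succ (q : ℝ) (n L : ℕ) : diag q n L ⊆ diag q n (L + 1) := by
  induction n generalizing L with
  | zero => exact subset_rfl
  | succ n ih =>
    intro d hd
    obtain ⟨M, x, rfl, hx, a, ha, rfl⟩ := exists_of_mem_diag hd
    exact cup_mem_diag (by omega) (ih M ha)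

theorem diag_finite (q : ℝ) (n L : ℕ) : (diag q n L).Finite := by
  induction n generalizing L with
  | zero => exact Set.finite_singleton _
  | succ n ih =>
    refine ((Set.finite_Iio L).biUnion fun x _ => (ih (L - 2)).image (cup q x)).subset ?_
    rintro d ⟨x, hx, a, ha, rfl⟩
    simp only [Set.mem_iUnion]
    exact ⟨x, Set.mem_Iio.2 (by omega), a, ha, rfl⟩

theorem diag_nonempty (q : ℝ) {n L : ℕ} (h : 2 * n ≤ L) : (diag q n L).Nonempty := by
  induction n generalizing L with
  | zero => exact ⟨vac, rfl⟩
  | succ n ih =>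
    obtain ⟨M, rfl⟩ : ∃ M, L = M + 2 := ⟨L - 2, by omega⟩
    obtain ⟨a, ha⟩ := ih (L := M) (by omega)
    exact ⟨_, cup_mem_diag (Nat.zero_le M) ha⟩

/-- The combinations of diagrams with nonnegative coefficients. -/
def cone (q : ℝ) (n L : ℕ) : Submodule ℝ≥0 Chain := Submodule.span ℝ≥0 (diag q n L)

theorem diag_subset_cone {q : ℝ} {n L : ℕ} {d : Chain} (hd : d ∈ diag q n L) :
    d ∈ cone q n L := Submodule.subset_span hd

theorem cone_smul {q : ℝ} {n L : ℕ} {f : Chain} (hf : f ∈ cone q n L) {r : ℝ} (hr : 0 ≤ r) :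
    (r : ℂ) • f ∈ cone q n L :=
  (cone q n L).smul_mem (⟨r, hr⟩ : ℝ≥0) hf

theorem cone_le_succ (q : ℝ) (n L : ℕ) : cone q n L ≤ cone q n (L + 1) :=
  Submodule.span_mono (diag_subset_succ q n L)

theorem map_mem_of_mem_cone {q : ℝ} {n L : ℕ} {C : Submodule ℝ≥0 Chain}
    {T : Module.End ℂ Chain} (h : ∀ d ∈ diag q n L, T d ∈ C) {f : Chain} (hf : f ∈ cone q n L) :
    T f ∈ C := by
  induction hf using Submodule.span_induction with
  | mem d hd => exact h d hd
  | zero => rw [map_zero]; exact C.zero_mem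
  | add f g _ _ hf hg => rw [map_add]; exact C.add_mem hf hg
  | smul r f _ hf =>
    have : T (r • f) = r • T f := T.map_smul ((r : ℝ) : ℂ) f
    rw [this]; exact C.smul_mem r hf

theorem cup_mem_cone {q : ℝ} {n L x : ℕ} (hx : x ≤ L) {f : Chain} (hf : f ∈ cone q n L) :
    cup q x f ∈ cone q (n + 1) (L + 2) :=
  map_mem_of_mem_cone (fun _ hd => diag_subset_cone (cup_mem_diag hx hd)) hf

/-- The absolute value of the off-diagonal matrix elements of the interaction. -/
def rate (q : ℝ) : ℝ := q / (1 + q ^ 2)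

theorem rate_pos {q : ℝ} (hq : 0 < q) : 0 < rate q := by unfold rate; positivity

theorem one_add_sq_ne_zero (q : ℝ) : (1 + (q : ℂ) ^ 2) ≠ 0 := by
  have : (1 + q ^ 2 : ℝ) ≠ 0 := by positivity
  exact_mod_cast this

theorem rate_cast (q : ℝ) : (-((q : ℂ) / (1 + (q : ℂ) ^ 2))) = -((rate q : ℝ) : ℂ) := by
  simp [rate]

/-- In the basis of diagrams the interaction has nonpositive off-diagonal matrix elements. -/
theorem hop_diag {q : ℝ} (hq : 0 < q) {n L x : ℕ} (hx : x + 2 ≤ L) {d : Chain}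
    (hd : d ∈ diag q n L) : hop q x d = d ∨ -hop q x d ∈ cone q n L := by
  induction n generalizing L x d with
  | zero =>
    obtain rfl : d = vac := hd
    right; rw [hop_vac, neg_zero]; exact Submodule.zero_mem _
  | succ n ih =>
    obtain ⟨M, y, rfl, hy, a, ha, rfl⟩ := exists_of_mem_diag hd
    rcases lt_trichotomy x y with h | rfl | h
    · obtain rfl | ⟨z, rfl⟩ : y = x + 1 ∨ ∃ z, y = z + 2 := by
        rcases Nat.lt_or_ge y 2 with h2 | h2
        · left; omega
        · exact Or.inr ⟨y - 2, by omega⟩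
      · right
        rw [hop_cup_succ, rate_cast, neg_smul, neg_neg]
        exact cone_smul (diag_subset_cone (cup_mem_diag (by omega) ha)) (rate_pos hq).le
      · by_cases hxz : x ≤ z
        · rw [hop_cup_far _ hxz]
          rcases ih (x := x) (by omega) ha with h1 | h1
          · left; rw [h1]
          · right; rw [← map_neg]; exact cup_mem_cone hy h1
        · obtain rfl : x = z + 1 := by omega
          right
          rw [hop_cup_succ, rate_cast, neg_smul, neg_neg]
          exact cone_smul (diag_subset_cone (cup_mem_diag (by omega) ha)) (rate_pos hq).le
    · left; exact hop_cup_self (one_add_sq_ne_zero q) x a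
    · by_cases hxy : x = y + 1
      · subst hxy
        right
        rw [hop_succ_cup, rate_cast, neg_smul, neg_neg]
        exact cone_smul (diag_subset_cone (cup_mem_diag (by omega) ha)) (rate_pos hq).le
      · obtain ⟨z, rfl⟩ : ∃ z, x = z + 2 := ⟨x - 2, by omega⟩
        rw [hop_far_cup _ (by omega : y ≤ z)]
        rcases ih (x := z) (by omega) ha with h1 | h1
        · left; rw [h1]
        · right; rw [← map_neg]; exact cup_mem_cone hy h1

/-- No diagram on `L` sites has an arc between the sites `L - 1` and `L`. -/
theorem neg_hop_last_diag {q : ℝ} (hq : 0 < q) {n x : ℕ} {d : Chain}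
    (hd : d ∈ diag q n (x + 1)) : -hop q x d ∈ cone q n (x + 2) := by
  induction n generalizing x d with
  | zero =>
    obtain rfl : d = vac := hd
    rw [hop_vac, neg_zero]; exact Submodule.zero_mem _
  | succ n ih =>
    obtain ⟨M, y, hM, hy, a, ha, rfl⟩ := exists_of_mem_diag hd
    obtain rfl : x = M + 1 := by omega
    by_cases hxy : y = M
    · subst hxy
      rw [hop_succ_cup, rate_cast, neg_smul, neg_neg]
      exact cone_smul (diag_subset_cone (cup_mem_diag (by omega) (diag_subset_succ _ _ _ ha)))
        (rate_pos hq).le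
    · obtain ⟨z, rfl⟩ : ∃ z, M = z + 1 := ⟨M - 1, by omega⟩
      rw [hop_far_cup _ (by omega : y ≤ z), ← map_neg]
      exact cup_mem_cone (by omega) (ih ha)

/-- Two diagrams are related if some interaction term maps the first one to a negative multiple
of the second one. -/
def Step (q : ℝ) (n L : ℕ) (d e : Chain) : Prop :=
  d ∈ diag q n L ∧ e ∈ diag q n L ∧ ∃ x, x + 2 ≤ L ∧ hop q x d = (-(rate q : ℂ)) • e

theorem Step.cup_zero {q : ℝ} {n L : ℕ} {d e : Chain} (h : Step q n L d e) :
    Step q (n + 1) (L + 2) (cup q 0 d) (cup q 0 e) := by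
  obtain ⟨hd, he, x, hx, h1⟩ := h
  refine ⟨cup_mem_diag (Nat.zero_le _) hd, cup_mem_diag (Nat.zero_le _) he, x + 2, by omega, ?_⟩
  rw [hop_far_cup _ (Nat.zero_le x), h1, map_smul]

theorem reach_cup_zero (q : ℝ) {n L x : ℕ} (hx : x ≤ L) {a : Chain} (ha : a ∈ diag q n L) :
    Relation.ReflTransGen (Step q (n + 1) (L + 2)) (cup q x a) (cup q 0 a) ∧
    Relation.ReflTransGen (Step q (n + 1) (L + 2)) (cup q 0 a) (cup q x a) := by
  induction x with
  | zero => exact ⟨.refl, .refl⟩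
  | succ x ih =>
    obtain ⟨h1, h2⟩ := ih (by omega)
    have m1 := cup_mem_diag (x := x) (by omega) ha
    have m2 := cup_mem_diag hx ha
    constructor
    · refine .head ⟨m2, m1, x, by omega, ?_⟩ h1
      rw [hop_cup_succ, rate_cast]
    · refine .tail h2 ⟨m1, m2, x + 1, by omega, ?_⟩
      rw [hop_succ_cup, rate_cast]

/-- The interaction connects all diagrams: arcs between neighbours can be moved through the
chain, one after the other. -/
theorem reach_diag (q : ℝ) {n L : ℕ} {d e : Chain} (hd : d ∈ diag q n L) (he : e ∈ diag q n L) :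
    Relation.ReflTransGen (Step q n L) d e := by
  induction n generalizing L d e with
  | zero =>
    obtain rfl : d = vac := hd
    obtain rfl : e = vac := he
    exact .refl
  | succ n ih =>
    obtain ⟨M, x, rfl, hx, a, ha, rfl⟩ := exists_of_mem_diag hd
    obtain ⟨M', y, hM, hy, b, hb, rfl⟩ := exists_of_mem_diag he
    obtain rfl : M = M' := by omega
    exact ((reach_cup_zero q hx ha).1.trans
      ((ih ha hb).lift (cup q 0) fun _ _ h => h.cup_zero)).trans (reach_cup_zero q hy hb).2

/-! ### A positive functional on the cone -/

/-- The product functional taking the value `1` at an up spin and `b x` at a down spin at `x`. -/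
def evalAt : ℕ → (ℕ → ℝ) → Chain →ₗ[ℂ] ℂ
  | 0, _ => LinearMap.proj fun _ => 0
  | M + 1, b => evalAt M (fun y => b (y + 1)) ∘ₗ (slice 0 + (b 0 : ℂ) • slice 1)

theorem evalAt_succ (M : ℕ) (b : ℕ → ℝ) (f : Chain) :
    evalAt (M + 1) b f =
      evalAt M (fun y => b (y + 1)) (slice 0 f) +
        (b 0 : ℂ) * evalAt M (fun y => b (y + 1)) (slice 1 f) := by
  simp [evalAt]

/-- The enumeration of all sites other than `x` and `x + 1`. -/
def skip (x y : ℕ) : ℕ := if y < x then y else y + 2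

theorem evalAt_cup (q : ℝ) {M x : ℕ} (hx : x ≤ M) (b : ℕ → ℝ) (f : Chain) :
    evalAt (M + 2) b (cup q x f) =
      ((b (x + 1) - q * b x : ℝ) : ℂ) * evalAt M (fun y => b (skip x y)) f := by
  induction x generalizing M b f with
  | zero =>
    rw [evalAt_succ, evalAt_succ, evalAt_succ]
    simp only [slice_zero_cup_zero, slice_one_cup_zero, map_neg, map_smul, slice_glue_same,
      slice_zero_glue_one, slice_one_glue_zero, map_zero, smul_eq_mul, skip, Nat.not_lt_zero,
      if_false, add_assoc]
    push_cast
    norm_num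
    ring
  | succ x ih =>
    obtain ⟨M, rfl⟩ : ∃ z, M = z + 1 := ⟨M - 1, by omega⟩
    have hs : ∀ y, skip (x + 1) (y + 1) = skip x y + 1 := by
      intro y; unfold skip; split_ifs <;> omega
    have h0 : skip (x + 1) 0 = 0 := by simp [skip]
    rw [evalAt_succ, evalAt_succ M]
    simp only [slice_cup_succ, hs, h0]
    rw [ih (by omega), ih (by omega)]
    ring

theorem skip_strictMono (x : ℕ) : StrictMono (skip x) := by
  intro y z h
  unfold skip; split_ifs <;> omega

theorem evalAt_vac (M : ℕ) (b : ℕ → ℝ) : evalAt M b vac = 1 := by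
  induction M generalizing b with
  | zero => simp [evalAt, vac]
  | succ M ih => simp [evalAt_succ, slice_zero_vac, slice_one_vac, ih]

/-- An arc between `x` and `x + 1` contributes a factor `b (x + 1) - q * b x > 0`. -/
theorem evalAt_diag {q : ℝ} (hq1 : q ≤ 1) {n M : ℕ} {b : ℕ → ℝ} (hb : StrictMono b)
    (hb0 : ∀ y, 0 < b y) {d : Chain} (hd : d ∈ diag q n M) :
    ∃ r : ℝ, 0 < r ∧ evalAt M b d = r := by
  induction n generalizing M b d with
  | zero =>
    obtain rfl : d = vac := hd
    exact ⟨1, one_pos, by simp [evalAt_vac]⟩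
  | succ n ih =>
    obtain ⟨L, x, rfl, hx, a, ha, rfl⟩ := exists_of_mem_diag hd
    obtain ⟨r, hr, h⟩ := ih (hb.comp (skip_strictMono x)) (fun y => hb0 _) ha
    refine ⟨(b (x + 1) - q * b x) * r, mul_pos ?_ hr, ?_⟩
    · have h1 := hb (Nat.lt_succ_self x)
      have h2 := mul_le_of_le_one_left (hb0 x).le hq1
      linarith
    · rw [evalAt_cup q hx]
      simp only [Function.comp_def] at h
      rw [h]; push_cast; rfl

theorem evalAt_congr (M : ℕ) (b : ℕ → ℝ) {f g : Chain} (h : res M f = res M g) :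
    evalAt M b f = evalAt M b g := by
  induction M generalizing b f g with
  | zero =>
    have h1 := congrArg (fun ψ : Space 0 => ψ fun _ => 0) h
    have h2 : (extend fun _ : Fin 0 => (0 : Fin 2)) = fun _ => 0 := by
      funext y; simp [extend]
    simpa [res_apply, h2, evalAt] using h1
  | succ M ih =>
    have h1 : ∀ c, res M (slice c f) = res M (slice c g) := by
      intro c
      ext σ
      have h2 : extend (Fin.cons c σ : Config (M + 1)) = push c (extend σ) := by
        funext y
        cases y with
        | zero => simp [extend]
        | succ y =>
          by_cases hy : y < M
          · have : (⟨y + 1, by omega⟩ : Fin (M + 1)) = Fin.succ ⟨y, hy⟩ := rfl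
            rw [push_succ, extend_of_lt _ (by omega), extend_of_lt _ hy, this, Fin.cons_succ]
          · simp [extend, hy]
      have h3 := congrArg (fun ψ : Space (M + 1) => ψ (Fin.cons c σ)) h
      simpa [res_apply, slice_apply, h2] using h3
    rw [evalAt_succ, evalAt_succ, ih _ (h1 0), ih _ (h1 1)]

/-! ### Diagrams span the highest weight vectors -/

/-- Insertion of an unpaired first site. -/
theorem glue_mem_diag {q : ℝ} {n L : ℕ} {d : Chain} (hd : d ∈ diag q n L) :
    glue 0 d ∈ diag q n (L + 1) := by
  induction n generalizing L d with
  | zero =>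
    obtain rfl : d = vac := hd
    rw [glue_zero_vac]; rfl
  | succ n ih =>
    obtain ⟨M, x, rfl, hx, a, ha, rfl⟩ := exists_of_mem_diag hd
    have h : glue 0 (cup q x a) = cup q (x + 1) (glue 0 a) := by
      apply chain_ext <;> simp
    rw [h]
    exact cup_mem_diag (by omega) (ih ha)

/-- A diagram with an unpaired site arises, up to the factor `-q`, as the component with first
spin down of the diagram in which a new first site is joined to its first unpaired site. -/
theorem exists_slice_one_eq {q : ℝ} {n L : ℕ} (h : 2 * n < L) {d : Chain}
    (hd : d ∈ diag q n L) : ∃ e ∈ diag q (n + 1) (L + 1), slice 1 e = (-(q : ℂ)) • d := by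
  induction n generalizing L d with
  | zero =>
    obtain rfl : d = vac := hd
    obtain ⟨M, rfl⟩ : ∃ M, L = M + 1 := ⟨L - 1, by omega⟩
    refine ⟨cup q 0 vac, cup_mem_diag (Nat.zero_le M) rfl, ?_⟩
    rw [slice_one_cup_zero, glue_zero_vac, neg_smul]
  | succ n ih =>
    obtain ⟨M, x, rfl, hx, a, ha, rfl⟩ := exists_of_mem_diag hd
    obtain ⟨e, he, h1⟩ := ih (by omega) ha
    refine ⟨cup q (x + 1) e, cup_mem_diag (by omega) he, ?_⟩
    rw [slice_cup_succ, h1, map_smul]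

/-- The vectors of the chain of length `L` that have weight `w` and are annihilated by the
raising generator. -/
structure IsHighest (q : ℝ) (L : ℕ) (w : ℤ) (f : Chain) : Prop where
  support : ∀ σ, f σ ≠ 0 → ∀ y, L ≤ y → σ y = 0
  weight_eq : mulWeight (fun w => w) L f = (w : ℂ) • f
  raise_eq : raise q L f = 0

theorem isHighest_diag {q : ℝ} (hq : 0 < q) {n L : ℕ} {d : Chain} (hd : d ∈ diag q n L) :
    mulWeight (fun w => w) L d = ((L - 2 * n : ℤ) : ℂ) • d ∧ raise q L d = 0 := by
  have hq' : (q : ℂ) ≠ 0 := by exact_mod_cast hq.ne'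
  induction n generalizing L d with
  | zero =>
    obtain rfl : d = vac := hd
    exact ⟨by rw [mulWeight_vac]; simp, raise_vac _ _⟩
  | succ n ih =>
    obtain ⟨M, x, rfl, hx, a, ha, rfl⟩ := exists_of_mem_diag hd
    obtain ⟨h1, h2⟩ := ih ha
    refine ⟨?_, ?_⟩
    · rw [mulWeight_cup _ _ hx, h1, map_smul]
      congr 2; push_cast; ring
    · rw [raise_cup hq' hx, h2, map_zero]

theorem support_cup {q : ℂ} {L x : ℕ} (hx : x ≤ L) {f : Chain}
    (hf : ∀ σ, f σ ≠ 0 → ∀ y, L ≤ y → σ y = 0) :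
    ∀ σ, cup q x f σ ≠ 0 → ∀ y, L + 2 ≤ y → σ y = 0 := by
  induction x generalizing L f with
  | zero =>
    intro σ hσ y hy
    have h : f (tail (tail σ)) ≠ 0 := by
      intro h
      refine hσ ?_
      simp [cup, glue_apply, h]
    have := hf _ h (y - 2) (by omega)
    simpa [tail, show y - 2 + 1 + 1 = y by omega] using this
  | succ x ih =>
    obtain ⟨L, rfl⟩ : ∃ z, L = z + 1 := ⟨L - 1, by omega⟩
    intro σ hσ y hy
    obtain ⟨y, rfl⟩ : ∃ z, y = z + 1 := ⟨y - 1, by omega⟩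
    rw [← push_tail σ] at hσ
    change slice (σ 0) (cup q (x + 1) f) (tail σ) ≠ 0 at hσ
    rw [slice_cup_succ] at hσ
    refine ih (by omega : x ≤ L) (fun τ hτ z hz => ?_) _ hσ y (by omega)
    exact hf _ hτ (z + 1) (by omega)

theorem support_diag {q : ℝ} {n L : ℕ} {d : Chain} (hd : d ∈ diag q n L) :
    ∀ σ, d σ ≠ 0 → ∀ y, L ≤ y → σ y = 0 := by
  induction n generalizing L d with
  | zero =>
    obtain rfl : d = vac := hd
    intro σ h y _
    by_contra hy
    exact h (if_neg fun h1 => hy (h1 y))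
  | succ n ih =>
    obtain ⟨M, x, rfl, hx, a, ha, rfl⟩ := exists_of_mem_diag hd
    exact support_cup hx (ih ha)

theorem IsHighest.slice_zero {q : ℝ} (hq : 0 < q) {L : ℕ} {w : ℤ} {f : Chain}
    (h : IsHighest q (L + 1) w f) (h1 : slice 1 f = 0) : IsHighest q L (w - 1) (slice 0 f) where
  support σ hσ y hy := h.support _ hσ (y + 1) (by omega)
  weight_eq := by
    have h2 := congrArg (slice 0) h.weight_eq
    rw [slice_zero_mulWeight, map_smul] at h2
    have h3 : mulWeight (fun v => ((v + 1 : ℤ) : ℂ)) L (slice 0 f)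
        = mulWeight (fun v => (v : ℂ)) L (slice 0 f) + slice 0 f := by
      funext σ; simp [mulWeight_apply, add_mul]
    rw [h3] at h2
    rw [eq_sub_of_add_eq h2]
    push_cast; module
  raise_eq := by
    have h2 := congrArg (slice 0) h.raise_eq
    rw [slice_zero_raise, h1, add_zero, map_zero, smul_eq_zero] at h2
    exact h2.resolve_left (by exact_mod_cast hq.ne')

theorem IsHighest.slice_one {q : ℝ} (hq : 0 < q) {L : ℕ} {w : ℤ} {f : Chain}
    (h : IsHighest q (L + 1) w f) : IsHighest q L (w + 1) (slice 1 f) where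
  support σ hσ y hy := h.support _ hσ (y + 1) (by omega)
  weight_eq := by
    have h2 := congrArg (slice 1) h.weight_eq
    rw [slice_one_mulWeight, map_smul] at h2
    have h3 : mulWeight (fun v => ((v - 1 : ℤ) : ℂ)) L (slice 1 f)
        = mulWeight (fun v => (v : ℂ)) L (slice 1 f) - slice 1 f := by
      funext σ; simp [mulWeight_apply, sub_mul]
    rw [h3] at h2
    rw [eq_add_of_sub_eq h2]
    push_cast; module
  raise_eq := by
    have h2 := congrArg (slice 1) h.raise_eq
    rw [slice_one_raise, map_zero, smul_eq_zero] at h2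
    exact h2.resolve_left (inv_ne_zero (by exact_mod_cast hq.ne'))

theorem IsHighest.sub {q : ℝ} {L : ℕ} {w : ℤ} {f g : Chain}
    (hf : IsHighest q L w f) (hg : IsHighest q L w g) : IsHighest q L w (f - g) where
  support σ hσ y hy := by
    rcases eq_or_ne (f σ) 0 with h | h
    · refine hg.support σ (fun h1 => hσ ?_) y hy
      simp [h, h1]
    · exact hf.support σ h y hy
  weight_eq := by rw [map_sub, hf.weight_eq, hg.weight_eq, smul_sub]
  raise_eq := by rw [map_sub, hf.raise_eq, hg.raise_eq, sub_zero]

theorem IsHighest.of_mem_span {q : ℝ} (hq : 0 < q) {n L : ℕ} {f : Chain}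
    (hf : f ∈ Submodule.span ℂ (diag q n L)) : IsHighest q L (L - 2 * n) f := by
  induction hf using Submodule.span_induction with
  | mem d hd =>
    exact ⟨support_diag hd, (isHighest_diag hq hd).1, (isHighest_diag hq hd).2⟩
  | zero => exact ⟨fun σ h => absurd rfl h, by simp, by simp⟩
  | add f g _ _ hf hg =>
    refine ⟨fun σ hσ y hy => ?_, ?_, ?_⟩
    · rcases eq_or_ne (f σ) 0 with h | h
      · refine hg.support σ (fun h1 => hσ ?_) y hy
        simp [h, h1]
      · exact hf.support σ h y hy
    · rw [map_add, hf.weight_eq, hg.weight_eq, smul_add]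
    · rw [map_add, hf.raise_eq, hg.raise_eq, add_zero]
  | smul a f _ hf =>
    refine ⟨fun σ hσ y hy => hf.support σ (fun h1 => hσ ?_) y hy, ?_, ?_⟩
    · simp [h1]
    · rw [map_smul, hf.weight_eq, smul_comm]
    · rw [map_smul, hf.raise_eq, smul_zero]

theorem IsHighest.eq_zero {q : ℝ} (hq : 0 < q) {L : ℕ} {w : ℤ} {f : Chain}
    (h : IsHighest q L w f) (hw : w < 0 ∨ (L : ℤ) < w) : f = 0 := by
  rcases hw with hw | hw
  · exact (isRep_chain hq L).eq_zero_of_neg hq h.weight_eq h.raise_eq hw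
  · exact (isRep_chain hq L).eq_zero_of_lt h.weight_eq (Or.inr hw)

/-- The highest weight vectors with `n` down spins are combinations of diagrams with `n` arcs. -/
theorem IsHighest.mem_span {q : ℝ} (hq : 0 < q) {n L : ℕ} {f : Chain}
    (hf : IsHighest q L (L - 2 * n) f) : f ∈ Submodule.span ℂ (diag q n L) := by
  induction L generalizing n f with
  | zero =>
    cases n with
    | zero =>
      refine Submodule.mem_span_singleton.2 ⟨f fun _ => 0, ?_⟩
      funext σ
      by_cases h : ∀ y, σ y = 0
      · obtain rfl : σ = fun _ => 0 := funext h
        simp [vac]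
      · have : f σ = 0 := by
          by_contra h0
          exact h fun y => hf.support σ h0 y (Nat.zero_le y)
        simp [vac, h, this]
    | succ n =>
      rw [hf.eq_zero hq (Or.inl (by push_cast; omega))]
      exact Submodule.zero_mem _
  | succ L ih =>
    -- A highest weight vector whose first spin is up comes from the shorter chain.
    have key : ∀ {n : ℕ} {g : Chain}, IsHighest q (L + 1 : ℕ) ((L + 1 : ℕ) - 2 * n) g →
        slice 1 g = 0 → g ∈ Submodule.span ℂ (diag q n (L + 1)) := by
      intro n g hg h1
      have h2 := hg.slice_zero hq h1
      have h3 := ih (n := n) (f := slice 0 g) (by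
        convert h2 using 1; push_cast; ring)
      have h4 : glue 0 (slice 0 g) = g := by
        apply chain_ext <;> simp [h1]
      rw [← h4]
      have h5 : Submodule.span ℂ (diag q n L)
          ≤ (Submodule.span ℂ (diag q n (L + 1))).comap (glue 0) :=
        Submodule.span_le.2 fun d hd => Submodule.subset_span (glue_mem_diag hd)
      exact h5 h3
    by_cases hn : L + 1 < 2 * n
    · rw [hf.eq_zero hq (Or.inl (by push_cast; omega))]
      exact Submodule.zero_mem _
    cases n with
    | zero =>
      refine key hf ((hf.slice_one hq).eq_zero hq (Or.inr ?_))
      push_cast; omega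
    | succ n =>
      have h1 := ih (n := n) (f := slice 1 f) (by
        convert hf.slice_one hq using 1; push_cast; ring)
      have h2 : Submodule.span ℂ (diag q n L)
          ≤ (Submodule.span ℂ (diag q (n + 1) (L + 1))).map (slice 1) := by
        refine Submodule.span_le.2 fun d hd => ?_
        obtain ⟨e, he, h3⟩ := exists_slice_one_eq (by omega) hd
        have hq' : (-(q : ℂ)) ≠ 0 := neg_ne_zero.2 (by exact_mod_cast hq.ne')
        refine ⟨(-(q : ℂ))⁻¹ • e, Submodule.smul_mem _ _ (Submodule.subset_span he), ?_⟩
        rw [map_smul, h3, smul_smul, inv_mul_cancel₀ hq', one_smul]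
      obtain ⟨g, hg, hgf⟩ := h2 h1
      have h3 := key (hf.sub (IsHighest.of_mem_span hq hg)) (by rw [map_sub, hgf, sub_self])
      have h4 := Submodule.add_mem _ h3 hg
      rwa [sub_add_cancel] at h4

/-! ### Growth of the powers of the shifted Hamiltonian on the cone -/

open Filter Topology

/-- A constant minus the Hamiltonian of the first `L` sites. -/
def shift (q K : ℝ) (L : ℕ) : Module.End ℂ Chain := (K : ℂ) • 1 - energy q L

theorem shift_apply (q K : ℝ) (L : ℕ) (f : Chain) :
    shift q K L f = (K : ℂ) • f - energy q L f := rfl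

theorem shift_eq_sum (q K : ℝ) (L : ℕ) (f : Chain) :
    shift q K L f =
      ((K - (L - 1 : ℕ) : ℝ) : ℂ) • f + ∑ x ∈ Finset.range (L - 1), (f - hop q x f) := by
  rw [shift_apply, energy_apply, Finset.sum_sub_distrib, Finset.sum_const, Finset.card_range]
  push_cast
  module

theorem sub_hop_mem {q : ℝ} (hq : 0 < q) {n L x : ℕ} (hx : x + 2 ≤ L) {d : Chain}
    (hd : d ∈ diag q n L) : d - hop q x d ∈ cone q n L := by
  rcases hop_diag hq hx hd with h | h
  · rw [h, sub_self]; exact Submodule.zero_mem _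
  · rw [sub_eq_add_neg]; exact Submodule.add_mem _ (diag_subset_cone hd) h

theorem shift_sub_self_diag {q K : ℝ} (hq : 0 < q) {n L : ℕ} (hK : (L : ℝ) + 1 ≤ K) {d : Chain}
    (hd : d ∈ diag q n L) : shift q K L d - d ∈ cone q n L := by
  have h1 : shift q K L d - d = ((K - (L - 1 : ℕ) - 1 : ℝ) : ℂ) • d
      + ∑ x ∈ Finset.range (L - 1), (d - hop q x d) := by
    rw [shift_eq_sum]; push_cast; module
  rw [h1]
  refine Submodule.add_mem _ (cone_smul (diag_subset_cone hd) ?_) (Submodule.sum_mem _ ?_)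
  · have : ((L - 1 : ℕ) : ℝ) ≤ L := by exact_mod_cast Nat.sub_le L 1
    linarith
  · intro x hx
    exact sub_hop_mem hq (by have := Finset.mem_range.1 hx; omega) hd

theorem shift_mem {q K : ℝ} (hq : 0 < q) {n L : ℕ} (hK : (L : ℝ) + 1 ≤ K) {f : Chain}
    (hf : f ∈ cone q n L) : shift q K L f ∈ cone q n L := by
  refine map_mem_of_mem_cone (fun d hd => ?_) hf
  have := Submodule.add_mem _ (shift_sub_self_diag hq hK hd) (diag_subset_cone hd)
  rwa [sub_add_cancel] at this

theorem shift_pow_mem {q K : ℝ} (hq : 0 < q) {n L : ℕ} (hK : (L : ℝ) + 1 ≤ K) (k : ℕ) {f : Chain}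
    (hf : f ∈ cone q n L) : (shift q K L ^ k) f ∈ cone q n L := by
  induction k with
  | zero => exact hf
  | succ k ih => rw [pow_succ']; exact shift_mem hq hK ih

theorem shift_sub_step {q K : ℝ} (hq : 0 < q) {n L : ℕ} (hK : (L : ℝ) + 1 ≤ K) {d e : Chain}
    (h : Step q n L d e) : shift q K L d - (rate q : ℂ) • e ∈ cone q n L := by
  obtain ⟨hd, he, x, hx, h1⟩ := h
  have hx' : x ∈ Finset.range (L - 1) := Finset.mem_range.2 (by omega)
  have h2 : shift q K L d - (rate q : ℂ) • e = ((K - (L - 1 : ℕ) : ℝ) : ℂ) • d + d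
      + ∑ y ∈ (Finset.range (L - 1)).erase x, (d - hop q y d) := by
    rw [shift_eq_sum, ← Finset.add_sum_erase _ _ hx', h1]; module
  rw [h2]
  refine Submodule.add_mem _ (Submodule.add_mem _ (cone_smul (diag_subset_cone hd) ?_)
    (diag_subset_cone hd)) (Submodule.sum_mem _ ?_)
  · have : ((L - 1 : ℕ) : ℝ) ≤ L := by exact_mod_cast Nat.sub_le L 1
    linarith
  · intro y hy
    exact sub_hop_mem hq (by have := Finset.mem_range.1 (Finset.mem_of_mem_erase hy); omega) hd

/-- Irreducibility: some power of the shifted Hamiltonian connects any two diagrams. -/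
theorem exists_shift_pow_sub_mem {q K : ℝ} (hq : 0 < q) {n L : ℕ} (hK : (L : ℝ) + 1 ≤ K)
    {d e : Chain} (hd : d ∈ diag q n L) (he : e ∈ diag q n L) :
    ∃ (N : ℕ) (δ : ℝ), 0 < δ ∧ (shift q K L ^ N) d - (δ : ℂ) • e ∈ cone q n L := by
  have h := reach_diag q hd he
  clear hd
  induction h using Relation.ReflTransGen.head_induction_on with
  | refl => exact ⟨0, 1, one_pos, by simp⟩
  | head h1 _ ih =>
    obtain ⟨N, δ, hδ, h2⟩ := ih
    refine ⟨N + 1, rate q * δ, mul_pos (rate_pos hq) hδ, ?_⟩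
    have h3 := Submodule.add_mem _ (shift_pow_mem hq hK N (shift_sub_step hq hK h1))
      (cone_smul h2 (rate_pos hq).le)
    convert h3 using 1
    rw [pow_succ, Module.End.mul_apply, map_sub, map_smul]
    push_cast
    module

theorem shift_succ (q K : ℝ) (M : ℕ) (f : Chain) :
    shift q K (M + 2) f = shift q K (M + 1) f - hop q M f := by
  simp only [shift_apply, energy_apply, Nat.add_sub_cancel, Nat.add_succ_sub_one,
    Finset.sum_range_succ, sub_sub]

/-- On the cone the shifted Hamiltonian increases with the length of the chain. -/
theorem shift_succ_sub_mem {q K : ℝ} (hq : 0 < q) {n M : ℕ} {f : Chain}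
    (hf : f ∈ cone q n (M + 1)) :
    shift q K (M + 2) f - shift q K (M + 1) f ∈ cone q n (M + 2) := by
  rw [shift_succ, sub_sub_cancel_left]
  exact map_mem_of_mem_cone (T := -hop q M) (fun d hd => neg_hop_last_diag hq hd) hf

theorem shift_pow_succ_sub_mem {q K : ℝ} (hq : 0 < q) {n M : ℕ} (hK : ((M + 2 : ℕ) : ℝ) + 1 ≤ K)
    (k : ℕ) {f : Chain} (hf : f ∈ cone q n (M + 1)) :
    (shift q K (M + 2) ^ k) f - (shift q K (M + 1) ^ k) f ∈ cone q n (M + 2) := by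
  have hK' : ((M + 1 : ℕ) : ℝ) + 1 ≤ K := by push_cast at hK ⊢; linarith
  induction k with
  | zero => simp
  | succ k ih =>
    have h := Submodule.add_mem _ (shift_mem hq hK ih)
      (shift_succ_sub_mem (K := K) hq (shift_pow_mem hq hK' k hf))
    convert h using 1
    rw [pow_succ', pow_succ', Module.End.mul_apply, Module.End.mul_apply, map_sub]
    abel

/-- Some power of the shifted Hamiltonian of the longer chain exceeds that of the shorter one
by a positive multiple of the identity, on each diagram: a diagram is moved to one with an arc
at the end of the shorter chain, this arc is moved to the end of the longer chain, and the result
is moved back. -/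
theorem exists_gain_of_mem_diag {q K : ℝ} (hq : 0 < q) {n M : ℕ}
    (hK : ((M + 2 : ℕ) : ℝ) + 1 ≤ K) {d : Chain} (hd : d ∈ diag q (n + 1) (M + 1)) :
    ∃ (N : ℕ) (δ : ℝ), 0 < δ ∧
      (shift q K (M + 2) ^ N) d - (shift q K (M + 1) ^ N) d - (δ : ℂ) • d
        ∈ cone q (n + 1) (M + 2) := by
  have hK' : ((M + 1 : ℕ) : ℝ) + 1 ≤ K := by push_cast at hK ⊢; linarith
  obtain ⟨M', y, hM, hy, a, ha, hda⟩ := exists_of_mem_diag hd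
  obtain rfl : M = M' + 1 := by omega
  have he1 : cup q M' a ∈ diag q (n + 1) (M' + 1 + 1) := cup_mem_diag le_rfl ha
  have he2 : cup q (M' + 1) a ∈ diag q (n + 1) (M' + 1 + 2) :=
    cup_mem_diag le_rfl (diag_subset_succ _ _ _ ha)
  have hhop : hop q (M' + 1) (cup q M' a) = (-(rate q : ℂ)) • cup q (M' + 1) a := by
    rw [hop_succ_cup, rate_cast]
  generalize cup q M' a = e1 at *
  generalize cup q (M' + 1) a = e2 at *
  obtain ⟨N1, δ1, hδ1, h1⟩ := exists_shift_pow_sub_mem hq hK' hd he1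
  obtain ⟨N2, δ2, hδ2, h2⟩ := exists_shift_pow_sub_mem hq hK he2 (diag_subset_succ _ _ _ hd)
  refine ⟨N2 + (1 + N1), δ1 * rate q * δ2, mul_pos (mul_pos hδ1 (rate_pos hq)) hδ2, ?_⟩
  have hr : 0 ≤ δ1 * rate q := (mul_pos hδ1 (rate_pos hq)).le
  have h3 := shift_mem hq hK (shift_pow_succ_sub_mem hq hK N1 (diag_subset_cone hd))
  have h4 := shift_succ_sub_mem (K := K) hq h1
  have h5 := shift_pow_mem hq hK N2 (Submodule.add_mem _ h3 h4)
  have h6 := shift_pow_succ_sub_mem hq hK N2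
    (shift_pow_mem hq hK' (1 + N1) (diag_subset_cone hd))
  have h7 := Submodule.add_mem _ (Submodule.add_mem _ h5 h6) (cone_smul h2 hr)
  convert h7 using 1
  simp only [pow_add, pow_one, Module.End.mul_apply, map_sub, map_add, map_smul,
    shift_succ q K (M' + 1) e1, hhop]
  push_cast
  module

theorem gain_succ {q K : ℝ} (hq : 0 < q) {n M : ℕ} (hK : ((M + 2 : ℕ) : ℝ) + 1 ≤ K) {d : Chain}
    (hd : d ∈ diag q n (M + 1)) {N : ℕ} {δ : ℝ} (hδ : 0 < δ)
    (h : (shift q K (M + 2) ^ N) d - (shift q K (M + 1) ^ N) d - (δ : ℂ) • d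
        ∈ cone q n (M + 2)) :
    (shift q K (M + 2) ^ (N + 1)) d - (shift q K (M + 1) ^ (N + 1)) d - (δ : ℂ) • d
        ∈ cone q n (M + 2) := by
  have hK' : ((M + 1 : ℕ) : ℝ) + 1 ≤ K := by push_cast at hK ⊢; linarith
  have h1 := shift_mem hq hK h
  have h2 := shift_succ_sub_mem (K := K) hq (shift_pow_mem hq hK' N (diag_subset_cone hd))
  have h3 := cone_smul (shift_sub_self_diag hq hK (diag_subset_succ _ _ _ hd)) hδ.le
  have h4 := Submodule.add_mem _ (Submodule.add_mem _ h1 h2) h3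
  convert h4 using 1
  simp only [pow_succ', Module.End.mul_apply, map_sub, map_smul]
  module

/-- The finitely many diagrams admit a common power and a common gain. -/
theorem exists_gain {q K : ℝ} (hq : 0 < q) (n : ℕ) {M : ℕ} (hK : ((M + 2 : ℕ) : ℝ) + 1 ≤ K) :
    ∃ (N : ℕ) (δ : ℝ), 0 < δ ∧ ∀ d ∈ diag q (n + 1) (M + 1),
      (shift q K (M + 2) ^ N) d - (shift q K (M + 1) ^ N) d - (δ : ℂ) • d
        ∈ cone q (n + 1) (M + 2) := by
  have h : ∀ d ∈ diag q (n + 1) (M + 1), ∀ᶠ p : ℕ × ℝ in atTop ×ˢ 𝓝[>] 0,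
      (shift q K (M + 2) ^ p.1) d - (shift q K (M + 1) ^ p.1) d - (p.2 : ℂ) • d
        ∈ cone q (n + 1) (M + 2) := by
    intro d hd
    obtain ⟨N, δ, hδ, h1⟩ := exists_gain_of_mem_diag hq hK hd
    have h2 : ∀ k, N ≤ k → (shift q K (M + 2) ^ k) d - (shift q K (M + 1) ^ k) d - (δ : ℂ) • d
        ∈ cone q (n + 1) (M + 2) := by
      intro k hk
      induction k, hk using Nat.le_induction with
      | base => exact h1
      | succ k _ ih => exact gain_succ hq hK hd hδ ih
    have h3 : ∀ᶠ δ' : ℝ in 𝓝[>] 0, δ' ≤ δ :=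
      Filter.mem_of_superset (Ioo_mem_nhdsGT hδ) fun _ h => h.2.le
    filter_upwards [(eventually_ge_atTop N).prod_mk h3] with p hp
    have h4 := Submodule.add_mem _ (h2 p.1 hp.1)
      (cone_smul (diag_subset_cone (diag_subset_succ _ _ _ hd)) (sub_nonneg.2 hp.2))
    convert h4 using 1
    push_cast
    module
  have h1 := ((diag_finite q (n + 1) (M + 1)).eventually_all).2 h
  have hpos : ∀ᶠ δ : ℝ in 𝓝[>] 0, 0 < δ := self_mem_nhdsWithin
  have h2 : ∀ᶠ p : ℕ × ℝ in atTop ×ˢ 𝓝[>] 0, 0 < p.2 := hpos.prod_inr _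
  obtain ⟨p, hp1, hp2⟩ := (h1.and h2).exists
  exact ⟨p.1, p.2, hp2, hp1⟩

theorem shift_pow_mul_sub_mem {q K : ℝ} (hq : 0 < q) {n M : ℕ} (hK : ((M + 2 : ℕ) : ℝ) + 1 ≤ K)
    {N : ℕ} {δ : ℝ} (hδ : 0 < δ)
    (h : ∀ d ∈ diag q n (M + 1),
      (shift q K (M + 2) ^ N) d - (shift q K (M + 1) ^ N) d - (δ : ℂ) • d ∈ cone q n (M + 2))
    {f : Chain} (hf : f ∈ cone q n (M + 1)) (k : ℕ) :
    ((shift q K (M + 1) ^ N + (δ : ℂ) • 1) ^ k) f ∈ cone q n (M + 1) ∧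
    (shift q K (M + 2) ^ (N * k)) f - ((shift q K (M + 1) ^ N + (δ : ℂ) • 1) ^ k) f
      ∈ cone q n (M + 2) := by
  have hK' : ((M + 1 : ℕ) : ℝ) + 1 ≤ K := by push_cast at hK ⊢; linarith
  induction k with
  | zero => simpa using hf
  | succ k ih =>
    obtain ⟨h1, h2⟩ := ih
    rw [pow_succ', Module.End.mul_apply]
    generalize ((shift q K (M + 1) ^ N + (δ : ℂ) • 1) ^ k) f = g at *
    constructor
    · exact Submodule.add_mem _ (shift_pow_mem hq hK' N h1) (cone_smul h1 hδ.le)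
    · have h3 := map_mem_of_mem_cone
        (T := shift q K (M + 2) ^ N - shift q K (M + 1) ^ N - (δ : ℂ) • 1) h h1
      have h4 := Submodule.add_mem _ (shift_pow_mem hq hK N h2) h3
      convert h4 using 1
      rw [Nat.mul_succ, add_comm (N * k) N, pow_add, Module.End.mul_apply]
      simp only [LinearMap.sub_apply, LinearMap.add_apply, LinearMap.smul_apply,
        Module.End.one_apply, map_sub]
      abel

/-! ### Norm estimates -/

/-- A linear section of `res L`. -/
def lift (L : ℕ) : Space L →ₗ[ℂ] Chain where
  toFun ψ := fun σ => ψ fun i => σ i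
  map_add' _ _ := rfl
  map_smul' _ _ := rfl

theorem lift_apply {L : ℕ} (ψ : Space L) (σ : ℕ → Fin 2) : lift L ψ σ = ψ fun i => σ i := rfl

theorem res_lift {L : ℕ} (ψ : Space L) : res L (lift L ψ) = ψ := by
  ext σ
  simp [res_apply, lift_apply]

theorem res_lift_res (M : ℕ) (f : Chain) :
    res M (lift (M + 1) (res (M + 1) f)) = res M f := by
  ext σ
  have h : (extend fun i : Fin (M + 1) => extend σ i) = extend σ := by
    funext y
    by_cases hy : y < M + 1
    · rw [extend_of_lt _ hy]
    · simp [extend, hy, show ¬ y < M by omega]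
  simp [res_apply, lift_apply, h]

theorem exists_norm_le {X Y : Type*} [NormedAddCommGroup X] [NormedSpace ℂ X]
    [FiniteDimensional ℂ X] [NormedAddCommGroup Y] [NormedSpace ℂ Y] (T : X →ₗ[ℂ] Y) :
    ∃ C : ℝ, 0 < C ∧ ∀ v, ‖T v‖ ≤ C * ‖v‖ := by
  refine ⟨‖LinearMap.toContinuousLinearMap T‖ + 1, by positivity, fun v => ?_⟩
  have := (LinearMap.toContinuousLinearMap T).le_opNorm v
  rw [LinearMap.coe_toContinuousLinearMap'] at this
  nlinarith [norm_nonneg v]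

theorem exists_evalAt_le (M : ℕ) (b : ℕ → ℝ) :
    ∃ C : ℝ, 0 < C ∧ ∀ f, (evalAt M b f).re ≤ C * ‖res M f‖ := by
  obtain ⟨C, hC, h⟩ := exists_norm_le (evalAt M b ∘ₗ lift M)
  refine ⟨C, hC, fun f => (Complex.re_le_norm _).trans ?_⟩
  have := h (res M f)
  rwa [LinearMap.comp_apply, evalAt_congr M b (res_lift (res M f))] at this

/-- The cone is generated by finitely many diagrams with positive values, so the functional
dominates the norm on it. -/
theorem exists_norm_le_evalAt {q : ℝ} (hq1 : q ≤ 1) (n M : ℕ) {b : ℕ → ℝ} (hb : StrictMono b)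
    (hb0 : ∀ y, 0 < b y) :
    ∃ c : ℝ, 0 < c ∧ ∀ f ∈ cone q n M, c * ‖res M f‖ ≤ (evalAt M b f).re := by
  have h : ∀ d ∈ diag q n M, ∀ᶠ c : ℝ in 𝓝[>] 0, c * ‖res M d‖ ≤ (evalAt M b d).re := by
    intro d hd
    obtain ⟨r, hr, h1⟩ := evalAt_diag hq1 hb hb0 hd
    rw [h1, Complex.ofReal_re]
    have h2 : Tendsto (fun c : ℝ => c * ‖res M d‖) (𝓝[>] 0) (𝓝 (0 * ‖res M d‖)) :=
      (tendsto_nhdsWithin_of_tendsto_nhds tendsto_id).mul_const _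
    rw [zero_mul] at h2
    exact h2.eventually_le_const hr
  obtain ⟨c, hc1, hc2⟩ := (((diag_finite q n M).eventually_all.2 h).and
    (self_mem_nhdsWithin : Set.Ioi (0 : ℝ) ∈ 𝓝[>] 0)).exists
  refine ⟨c, hc2, fun f hf => ?_⟩
  have hc0 : 0 < c := hc2
  induction hf using Submodule.span_induction with
  | mem d hd => exact hc1 d hd
  | zero => simp
  | add f g _ _ hf hg =>
    rw [map_add, map_add, Complex.add_re]
    nlinarith [norm_add_le (res M f) (res M g)]
  | smul r f _ hf =>
    have h1 : r • f = ((r : ℝ) : ℂ) • f := rfl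
    rw [h1, map_smul, map_smul, norm_smul, smul_eq_mul, Complex.re_ofReal_mul,
      Complex.norm_of_nonneg r.coe_nonneg]
    nlinarith [r.coe_nonneg]

theorem emb_res {L : ℕ} {f : Chain} (hf : ∀ σ, f σ ≠ 0 → ∀ y, L ≤ y → σ y = 0) :
    emb L (res L f) = f := by
  funext σ
  by_cases h : ∀ y, L ≤ y → σ y = 0
  · have h1 : (extend fun i : Fin L => σ i) = σ := by
      funext y
      by_cases hy : y < L
      · rw [extend_of_lt _ hy]
      · rw [h y (by omega)]; simp [extend, hy]
    simp only [emb, if_pos h, res_apply, h1]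
  · simp only [emb, if_neg h]
    by_contra h1
    exact h (hf σ fun h2 => h1 h2.symm)

theorem support_emb {L : ℕ} (ψ : Space L) : ∀ σ, emb L ψ σ ≠ 0 → ∀ y, L ≤ y → σ y = 0 := by
  intro σ h
  by_contra h1
  exact h (if_neg h1)

theorem isHighest_emb {q : ℝ} (hq : 0 < q) {n L : ℕ} {φ : Space L}
    (hφ : φ ∈ highest (opD L) (opE q L) (L - 2 * n)) : IsHighest q L (L - 2 * n) (emb L φ) where
  support := support_emb φ
  weight_eq := by
    have h1 := (mem_highest.1 hφ).1
    rw [← res_emb φ, opD_res, ← map_smul] at h1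
    have h2 := congrArg (emb L) h1
    rw [emb_res, emb_res] at h2
    · rw [h2]; push_cast; rfl
    · intro σ h; exact support_emb φ σ fun h3 => h (by simp [h3])
    · intro σ h; exact support_emb φ σ fun h3 => h (by simp [mulWeight_apply, h3])
  raise_eq := by
    have h1 := (mem_highest.1 hφ).2
    rw [← res_emb φ, opE_res hq] at h1
    have h2 := congrArg (emb L) h1
    rw [emb_res] at h2
    · rw [h2]; funext σ; simp [emb]
    · intro σ h y hy
      rw [raise_apply (by exact_mod_cast hq.ne')] at h
      obtain ⟨x, hx, h3⟩ := Finset.exists_ne_zero_of_sum_ne_zero h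
      have hxy : y ≠ x := by have := Finset.mem_range.1 hx; omega
      have h4 : emb L φ (Function.update σ x 1) ≠ 0 := fun h4 => h3 (by simp [h4])
      have h5 := support_emb φ _ h4 y hy
      rwa [Function.update_of_ne hxy] at h5

theorem res_mem_highest {q : ℝ} (hq : 0 < q) {n L : ℕ} {d : Chain} (hd : d ∈ diag q n L) :
    res L d ∈ highest (opD L) (opE q L) (L - 2 * n) := by
  obtain ⟨h1, h2⟩ := isHighest_diag hq hd
  refine mem_highest.2 ⟨?_, ?_⟩
  · rw [opD_res, h1, map_smul]; push_cast; rfl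
  · rw [opE_res hq, h2, map_zero]

theorem exists_inner_diag_ne_zero {q : ℝ} (hq : 0 < q) {n L : ℕ} {φ : Space L}
    (hφ : φ ∈ highest (opD L) (opE q L) (L - 2 * n)) (h0 : φ ≠ 0) :
    ∃ d ∈ diag q n L, inner ℂ φ (res L d) ≠ 0 := by
  by_contra! h
  have h1 : Submodule.span ℂ (diag q n L) ≤ LinearMap.ker ((innerₛₗ ℂ φ) ∘ₗ res L) :=
    Submodule.span_le.2 fun d hd => h d hd
  have h2 : inner ℂ φ (res L (emb L φ)) = 0 := h1 ((isHighest_emb hq hφ).mem_span hq)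
  rw [res_emb] at h2
  exact h0 (inner_self_eq_zero.1 h2)

theorem sub_opH_isSymmetric (Δ K : ℝ) (L : ℕ) :
    ((K : ℂ) • 1 - opH Δ L : Module.End ℂ (Space L)).IsSymmetric := by
  intro u v
  simp only [LinearMap.sub_apply, LinearMap.smul_apply, Module.End.one_apply, inner_sub_left,
    inner_sub_right, inner_smul_left, inner_smul_right, Complex.conj_ofReal,
    opH_isSymmetric Δ L u v]

theorem res_shift {Δ q : ℝ} (hq : 0 < q) (hq1 : q ≤ 1) (hΔ : Δ = (q + q⁻¹) / 2)
    (K : ℝ) (L : ℕ) (f : Chain) :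
    res L (shift q K L f) = ((K : ℂ) • 1 - opH Δ L) (res L f) := by
  rw [shift_apply, map_sub, map_smul, ← opH_res hq hq1 hΔ]; rfl

theorem res_shift_pow {Δ q : ℝ} (hq : 0 < q) (hq1 : q ≤ 1) (hΔ : Δ = (q + q⁻¹) / 2)
    (K : ℝ) (L k : ℕ) (f : Chain) :
    res L ((shift q K L ^ k) f) = (((K : ℂ) • 1 - opH Δ L) ^ k) (res L f) := by
  induction k with
  | zero => rfl
  | succ k ih =>
    rw [pow_succ', pow_succ', Module.End.mul_apply, Module.End.mul_apply,
      res_shift hq hq1 hΔ, ih]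

/-- An eigenvector of the shorter chain forces the powers of the shifted Hamiltonian of the longer
chain to grow faster than the powers of its eigenvalue. -/
theorem exists_growth {Δ q : ℝ} (hq : 0 < q) (hq1 : q ≤ 1) (hΔ : Δ = (q + q⁻¹) / 2)
    {n M : ℕ} {K : ℝ} (hK : ((M + 2 : ℕ) : ℝ) + 1 ≤ K) {φ : Space (M + 1)}
    (hφ : φ ∈ highest (opD (M + 1)) (opE q (M + 1)) ((M + 1 : ℕ) - 2 * (n + 1 : ℕ)))
    (h0 : φ ≠ 0) {μ : ℝ} (hμ : ((K : ℂ) • 1 - opH Δ (M + 1)) φ = (μ : ℂ) • φ) (hμ0 : 0 ≤ μ) :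
    ∃ v ∈ highest (opD (M + 2)) (opE q (M + 2)) ((M + 2 : ℕ) - 2 * (n + 1 : ℕ)),
      ∃ (N : ℕ) (δ c : ℝ), 0 < δ ∧ 0 < c ∧
        ∀ k, c * (μ ^ N + δ) ^ k ≤ ‖(((K : ℂ) • 1 - opH Δ (M + 2)) ^ (N * k)) v‖ := by
  obtain ⟨a, ha, hin⟩ := exists_inner_diag_ne_zero hq hφ h0
  obtain ⟨N, δ, hδ, hgain⟩ := exists_gain hq n hK
  have hb : StrictMono fun y : ℕ => (y : ℝ) + 1 := fun y z h => by
    have : (y : ℝ) < z := by exact_mod_cast h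
    simpa using this
  obtain ⟨c, hc, hlow⟩ := exists_norm_le_evalAt hq1 (n + 1) (M + 2) hb (fun y => by positivity)
  obtain ⟨C, hC, hup⟩ := exists_evalAt_le (M + 2) fun y : ℕ => (y : ℝ) + 1
  obtain ⟨C', hC', hres⟩ := exists_norm_le (res (M + 1) ∘ₗ lift (M + 2))
  have hsym := sub_opH_isSymmetric Δ K (M + 1)
  have hp1 : ∀ f, inner ℂ φ (res (M + 1) (shift q K (M + 1) f))
      = (μ : ℂ) * inner ℂ φ (res (M + 1) f) := by
    intro f
    rw [res_shift hq hq1 hΔ, ← hsym, hμ, inner_smul_left, Complex.conj_ofReal]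
  have hp2 : ∀ (k : ℕ) (f), inner ℂ φ (res (M + 1) ((shift q K (M + 1) ^ k) f))
      = (μ : ℂ) ^ k * inner ℂ φ (res (M + 1) f) := by
    intro k f
    induction k with
    | zero => simp
    | succ k ih => rw [pow_succ', Module.End.mul_apply, hp1, ih, pow_succ']; ring
  have hp3 : ∀ k : ℕ, inner ℂ φ
      (res (M + 1) (((shift q K (M + 1) ^ N + (δ : ℂ) • 1) ^ k) a))
      = ((μ ^ N + δ : ℝ) : ℂ) ^ k * inner ℂ φ (res (M + 1) a) := by
    intro k
    induction k with
    | zero => simp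
    | succ k ih =>
      rw [pow_succ', Module.End.mul_apply, LinearMap.add_apply, map_add, inner_add_right, hp2,
        LinearMap.smul_apply, Module.End.one_apply, map_smul, inner_smul_right, ih, pow_succ']
      push_cast; ring
  refine ⟨res (M + 2) a, res_mem_highest hq (diag_subset_succ _ _ _ ha), N, δ,
    ‖inner ℂ φ (res (M + 1) a)‖ * c / (‖φ‖ * C' * C), hδ, ?_, fun k => ?_⟩
  · have := norm_pos_iff.2 hin
    have := norm_pos_iff.2 h0
    positivity
  · obtain ⟨hg1, hg2⟩ := shift_pow_mul_sub_mem hq hK hδ hgain (diag_subset_cone ha) k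
    have h3 := hp3 k
    generalize ((shift q K (M + 1) ^ N + (δ : ℂ) • 1) ^ k) a = g at *
    have e1 : (μ ^ N + δ) ^ k * ‖inner ℂ φ (res (M + 1) a)‖ ≤ ‖φ‖ * ‖res (M + 1) g‖ := by
      have := norm_inner_le_norm (𝕜 := ℂ) φ (res (M + 1) g)
      rwa [h3, norm_mul, norm_pow, Complex.norm_of_nonneg (by positivity)] at this
    have e2 : ‖res (M + 1) g‖ ≤ C' * ‖res (M + 2) g‖ := by
      have := hres (res (M + 2) g)
      rwa [LinearMap.comp_apply, res_lift_res (M + 1) g] at this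
    have e3 := hlow g (cone_le_succ _ _ _ hg1)
    have e4 : (evalAt (M + 2) (fun y : ℕ => (y : ℝ) + 1) g).re
        ≤ (evalAt (M + 2) (fun y : ℕ => (y : ℝ) + 1) ((shift q K (M + 2) ^ (N * k)) a)).re := by
      have h5 := hlow _ hg2
      rw [map_sub (evalAt _ _), Complex.sub_re] at h5
      have : 0 ≤ c * ‖res (M + 2) ((shift q K (M + 2) ^ (N * k)) a - g)‖ := by positivity
      linarith
    have e5 := hup ((shift q K (M + 2) ^ (N * k)) a)
    rw [res_shift_pow hq hq1 hΔ] at e5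
    have hφ0 := norm_pos_iff.2 h0
    rw [div_mul_eq_mul_div, div_le_iff₀ (by positivity)]
    have e6 : c * ‖res (M + 2) g‖
        ≤ C * ‖(((K : ℂ) • 1 - opH Δ (M + 2)) ^ (N * k)) (res (M + 2) a)‖ := e3.trans (e4.trans e5)
    calc ‖inner ℂ φ (res (M + 1) a)‖ * c * (μ ^ N + δ) ^ k
        = ((μ ^ N + δ) ^ k * ‖inner ℂ φ (res (M + 1) a)‖) * c := by ring
      _ ≤ (‖φ‖ * (C' * ‖res (M + 2) g‖)) * c :=
          mul_le_mul_of_nonneg_right (e1.trans (mul_le_mul_of_nonneg_left e2 hφ0.le)) hc.le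
      _ = (‖φ‖ * C') * (c * ‖res (M + 2) g‖) := by ring
      _ ≤ (‖φ‖ * C') * (C * ‖(((K : ℂ) • 1 - opH Δ (M + 2)) ^ (N * k)) (res (M + 2) a)‖) := by
          gcongr
      _ = _ := by ring

/-! ### The sectors -/

theorem isInvariant_iff {q : ℝ} {L : ℕ} {W : Submodule ℂ (Space L)} :
    IsInvariant q W ↔
      (∀ v ∈ W, opD L v ∈ W) ∧ (∀ v ∈ W, opE q L v ∈ W) ∧ ∀ v ∈ W, opF q L v ∈ W := by
  have h : ∀ v, opD L v ∈ W ↔ Matrix.toEuclideanLin (total3 L) v ∈ W := fun v =>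
    W.smul_mem_iff (two_ne_zero (α := ℂ))
  constructor
  · intro hW
    exact ⟨fun v hv => (h v).2 (hW v hv).1, fun v hv => (hW v hv).2.1, fun v hv => (hW v hv).2.2⟩
  · rintro ⟨h1, h2, h3⟩ v hv
    exact ⟨(h v).1 (h1 v hv), h2 v hv, h3 v hv⟩

/-- The highest weight vectors with `n` down spins. -/
def topSpace (q : ℝ) (L n : ℕ) : Submodule ℂ (Space L) := highest (opD L) (opE q L) (L - 2 * n)

theorem top_eq {q : ℝ} {L n : ℕ} (h : 2 * n ≤ L) :
    topSpace q L n = highest (opD L) (opE q L) ((L - 2 * n : ℕ) : ℂ) := by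
  rw [topSpace]; congr 1; push_cast [h]; rfl

theorem top_le {q : ℝ} {L n : ℕ} :
    topSpace q L n ≤ highest (opD L) (opE q L) (((L : ℤ) - 2 * n : ℤ) : ℂ) := by
  rw [topSpace]; push_cast; rfl

/-- A highest weight vector generates an irreducible subrepresentation. -/
theorem isIrreducible_tower {q : ℝ} (hq : 0 < q) {L n : ℕ} (h : 2 * n ≤ L) {φ : Space L}
    (hφ : φ ∈ topSpace q L n) (h0 : φ ≠ 0) :
    IsIrreducible q (tower (opF q L) (ℂ ∙ φ)) ∧
      Module.finrank ℂ (tower (opF q L) (ℂ ∙ φ)) + 2 * n = L + 1 := by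
  have hr := isRep_space hq L
  have hsp := (Submodule.span_singleton_le_iff_mem _ _).2 (top_le hφ)
  refine ⟨⟨isInvariant_iff.2 ⟨hr.tower_D hsp, hr.tower_E hq hsp, IsRep.tower_F _ _⟩, ?_, ?_⟩, ?_⟩
  · exact (Submodule.ne_bot_iff _).2 ⟨φ, le_tower _ _ (Submodule.mem_span_singleton_self φ), h0⟩
  · intro U hU hinv
    obtain ⟨-, hE, hF⟩ := isInvariant_iff.1 hinv
    rw [top_eq h] at hφ
    by_cases hb : U = ⊥
    · exact Or.inl hb
    · exact Or.inr (le_antisymm hU (hr.tower_span_le_of_mem hq hφ hU hb hE hF))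
  · rw [top_eq h] at hφ
    rw [hr.finrank_tower_span hq hφ h0]
    omega

/-- An irreducible subrepresentation is generated by any of its highest weight vectors, and its
dimension determines the weight of the latter. -/
theorem sector_eq_tower {q : ℝ} (hq : 0 < q) {L n : ℕ} (h : 2 * n ≤ L) :
    sector q L n = tower (opF q L) (topSpace q L n) := by
  have hr := isRep_space hq L
  apply le_antisymm
  · refine sSup_le ?_
    rintro W ⟨⟨hinv, hW0, hirr⟩, hdim⟩
    obtain ⟨hD, hE, hF⟩ := isInvariant_iff.1 hinv
    obtain ⟨m, hm, φ, hφW, h0, hφ⟩ := hr.exists_highest hq hW0 hD hE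
    obtain ⟨⟨hinv', hne, -⟩, hdim'⟩ := isIrreducible_tower hq hm hφ h0
    have hle : tower (opF q L) (ℂ ∙ φ) ≤ W := IsRep.tower_span_le hφW hF
    have hW : tower (opF q L) (ℂ ∙ φ) = W := (hirr _ hle hinv').resolve_left hne
    rw [hW] at hdim'
    obtain rfl : m = n := by omega
    rw [← hW]
    exact IsRep.tower_span_le (le_tower _ _ hφ) (IsRep.tower_F _ _)
  · have hF : sector q L n ≤ (sector q L n).comap (opF q L) :=
      sSup_le fun W hW v hv =>
        (le_sSup hW : W ≤ sector q L n) ((isInvariant_iff.1 hW.1.1).2.2 v hv)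
    refine tower_le fun φ hφ k => pow_apply_mem (T := opF q L) (W := sector q L n) (fun v hv => hF hv) k ?_
    by_cases h0 : φ = 0
    · rw [h0]; exact Submodule.zero_mem _
    · exact (le_sSup (isIrreducible_tower hq h hφ h0) : _ ≤ sector q L n)
        (le_tower _ _ (Submodule.mem_span_singleton_self φ))

theorem sector_ne_bot {q : ℝ} (hq : 0 < q) (hq1 : q ≤ 1) {L n : ℕ} (h : 2 * n ≤ L) :
    sector q L n ≠ ⊥ := by
  obtain ⟨d, hd⟩ := diag_nonempty q h
  rw [sector_eq_tower hq h]
  refine (Submodule.ne_bot_iff _).2 ⟨res L d, le_tower _ _ (res_mem_highest hq hd), fun h0 => ?_⟩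
  have hb : StrictMono fun y : ℕ => (y : ℝ) + 1 := fun y z h => by
    have : (y : ℝ) < z := by exact_mod_cast h
    simpa using this
  obtain ⟨r, hr, h1⟩ := evalAt_diag hq1 hb (fun y => by positivity) hd
  rw [evalAt_congr L _ (h0.trans (map_zero (res L)).symm), map_zero] at h1
  exact hr.ne (by exact_mod_cast h1)

theorem opH_mem_sector {Δ q : ℝ} (hq : 0 < q) (hq1 : q ≤ 1) (hΔ : Δ = (q + q⁻¹) / 2) {L n : ℕ}
    (h : 2 * n ≤ L) : ∀ v ∈ sector q L n, opH Δ L v ∈ sector q L n := by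
  rw [sector_eq_tower hq h]
  have hle : tower (opF q L) (topSpace q L n)
      ≤ (tower (opF q L) (topSpace q L n)).comap (opH Δ L) := by
    refine tower_le fun φ hφ k => ?_
    have hk : ∀ k : ℕ, opH Δ L ((opF q L ^ k) φ) = (opF q L ^ k) (opH Δ L φ) := by
      intro k
      induction k with
      | zero => rfl
      | succ k ih =>
        rw [pow_succ', Module.End.mul_apply, Module.End.mul_apply, ← opF_opH hq hq1 hΔ, ih]
    rw [Submodule.mem_comap, hk]
    refine pow_mem_tower _ ?_ k
    obtain ⟨h1, h2⟩ := mem_highest.1 hφ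
    refine mem_highest.2 ⟨?_, ?_⟩
    · rw [opD_opH hq hq1 hΔ, h1, map_smul]
    · rw [opE_opH hq hq1 hΔ, h2, map_zero]
  exact fun v hv => hle hv

/-- An eigenvalue of the Hamiltonian in a sector has a highest weight eigenvector. -/
theorem exists_top_eigenvector {Δ q : ℝ} (hq : 0 < q) (hq1 : q ≤ 1) (hΔ : Δ = (q + q⁻¹) / 2)
    {L n : ℕ} (h : 2 * n ≤ L) {ψ : Space L} (hψ : ψ ∈ sector q L n) (h0 : ψ ≠ 0) {e : ℂ}
    (he : opH Δ L ψ = e • ψ) : ∃ φ ∈ topSpace q L n, φ ≠ 0 ∧ opH Δ L φ = e • φ := by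
  rw [sector_eq_tower hq h] at hψ
  obtain ⟨k, hk, hk0⟩ := (isRep_space hq L).exists_E_pow_mem hq (top_eq h).le hψ h0
  refine ⟨_, hk, hk0, ?_⟩
  clear hk hk0
  induction k with
  | zero => exact he
  | succ k ih => rw [pow_succ', Module.End.mul_apply, ← opE_opH hq hq1 hΔ, ih, map_smul]

/-! ### The minimal energies -/

/-- A symmetric operator attains its minimum on the unit vectors of an invariant subspace, at an
eigenvector. -/
theorem exists_min_eigenvector {X : Type*} [NormedAddCommGroup X] [InnerProductSpace ℂ X]
    [FiniteDimensional ℂ X] {T : Module.End ℂ X} (hT : T.IsSymmetric) {S : Submodule ℂ X}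
    (hS : ∀ v ∈ S, T v ∈ S) (h0 : S ≠ ⊥) :
    ∃ e : ℝ, (∃ ψ ∈ S, ψ ≠ 0 ∧ T ψ = (e : ℂ) • ψ) ∧
      ∀ v ∈ S, e * ‖v‖ ^ 2 ≤ (inner ℂ v (T v)).re := by
  have : Nontrivial S := Submodule.nontrivial_iff_ne_bot.2 h0
  have hsym : (T.restrict hS).IsSymmetric := fun u v => hT u v
  have hev := hsym.hasEigenvalue_iInf_of_finiteDimensional
  obtain ⟨ψ, hψ⟩ := hev.exists_hasEigenvector
  refine ⟨_, ⟨ψ, ψ.2, fun h => hψ.2 (Subtype.ext h), congrArg Subtype.val hψ.apply_eq_smul⟩, ?_⟩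
  intro v hv
  rcases eq_or_ne v 0 with rfl | hv0
  · simp
  · obtain ⟨C, hC, hTC⟩ := exists_norm_le (T.restrict hS)
    have hbdd : BddBelow (Set.range fun x : { x : S // x ≠ 0 } =>
        RCLike.re (inner ℂ (T.restrict hS x) (x : S)) / ‖(x : S)‖ ^ 2) := by
      refine ⟨-C, ?_⟩
      rintro _ ⟨⟨x, hx⟩, rfl⟩
      have hx0 := norm_pos_iff.2 hx
      simp only
      rw [le_div_iff₀ (by positivity)]
      have h1 := (abs_le.1 ((RCLike.abs_re_le_norm (inner ℂ (T.restrict hS x) x)).trans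
        (norm_inner_le_norm (𝕜 := ℂ) _ _))).1
      nlinarith [hTC x]
    have h1 := ciInf_le hbdd ⟨⟨v, hv⟩, fun h => hv0 (congrArg Subtype.val h)⟩
    rw [le_div_iff₀ (by have := norm_pos_iff.2 hv0; positivity)] at h1
    refine h1.trans (le_of_eq ?_)
    rw [← hT]; rfl

/-- The powers of a positive operator grow at most like the powers of its maximal expectation
value. -/
theorem norm_pow_apply_le {X : Type*} [NormedAddCommGroup X] [InnerProductSpace ℂ X]
    {T : Module.End ℂ X} (hT : T.IsSymmetric) (hpos : ∀ v, 0 ≤ (inner ℂ v (T v)).re)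
    {S : Submodule ℂ X} (hS : ∀ v ∈ S, T v ∈ S) {μ : ℝ} (hμ : 0 < μ)
    (hle : ∀ v ∈ S, (inner ℂ v (T v)).re ≤ μ * ‖v‖ ^ 2) {v : X} (hv : v ∈ S) (k : ℕ) :
    ‖(T ^ k) v‖ ≤ μ ^ k * ‖v‖ := by
  have h1 : ∀ v ∈ S, ‖T v‖ ≤ μ * ‖v‖ := by
    intro v hv
    -- Positivity is applied to the vector `v - μ⁻¹ T v`.
    have h2 := hpos ((μ : ℂ) • v - T v)
    have h3 := hle v hv
    have h4 := hle (T v) (hS v hv)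
    have h5 : (inner ℂ ((μ : ℂ) • v - T v) (T ((μ : ℂ) • v - T v))).re =
        μ ^ 2 * (inner ℂ v (T v)).re - 2 * μ * ‖T v‖ ^ 2 + (inner ℂ (T v) (T (T v))).re := by
      have h6 : inner ℂ v (T (T v)) = inner ℂ (T v) (T v) := (hT v (T v)).symm
      simp only [map_sub, map_smul, inner_sub_left, inner_sub_right, inner_smul_left,
        inner_smul_right, Complex.conj_ofReal, h6, Complex.sub_re, Complex.re_ofReal_mul]
      have h8 : (inner ℂ (T v) (T v)).re = ‖T v‖ ^ 2 := inner_self_eq_norm_sq (𝕜 := ℂ) (T v)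
      rw [h8]
      ring
    rw [h5] at h2
    have h7 : ‖T v‖ ^ 2 ≤ (μ * ‖v‖) ^ 2 := by
      refine le_of_mul_le_mul_left ?_ hμ
      nlinarith [mul_le_mul_of_nonneg_left h3 (sq_nonneg μ)]
    exact (pow_le_pow_iff_left₀ (norm_nonneg _) (by positivity) two_ne_zero).1 h7
  induction k with
  | zero => simp
  | succ k ih =>
    rw [pow_succ', Module.End.mul_apply]
    calc _ ≤ μ * ‖(T ^ k) v‖ := h1 _ (pow_apply_mem hS k hv)
      _ ≤ μ * (μ ^ k * ‖v‖) := by gcongr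
      _ = _ := by ring

theorem le_of_forall_pow_le {a b c C : ℝ} (hb : 0 ≤ b) (hc : 0 < c)
    (h : ∀ k : ℕ, c * a ^ k ≤ C * b ^ k) : a ≤ b := by
  by_contra! hlt
  rcases hb.eq_or_lt with rfl | hb
  · have h1 := h 1
    simp only [pow_one, mul_zero] at h1
    nlinarith
  · obtain ⟨k, hk⟩ := pow_unbounded_of_one_lt (C / c) ((one_lt_div hb).2 hlt)
    rw [div_pow, div_lt_div_iff₀ hc (by positivity)] at hk
    linarith [h k]

/-- The minimum of the energies of a sector exists, is attained at an eigenvector, and bounds the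
quadratic form of the Hamiltonian on the sector. -/
theorem isLeast_energies {Δ : ℝ} (hΔ : 1 ≤ Δ) {L n : ℕ} (h : 2 * n ≤ L) :
    IsLeast (energies Δ L n) (minEnergy Δ L n) ∧
      (∃ φ ∈ topSpace (qParam Δ) L n, φ ≠ 0 ∧ opH Δ L φ = (minEnergy Δ L n : ℂ) • φ) ∧
      ∀ v ∈ sector (qParam Δ) L n, minEnergy Δ L n * ‖v‖ ^ 2 ≤ (inner ℂ v (opH Δ L v)).re := by
  obtain ⟨hq, hq1, hΔq⟩ := (qParam_unique hΔ _).2 rfl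
  obtain ⟨e, ⟨ψ, hψ, hψ0, hev⟩, hmin⟩ := exists_min_eigenvector (opH_isSymmetric Δ L)
    (opH_mem_sector hq hq1 hΔq h) (sector_ne_bot hq hq1 h)
  have hleast : IsLeast (energies Δ L n) e := by
    constructor
    · have hn : ‖ψ‖ ≠ 0 := norm_ne_zero_iff.2 hψ0
      refine ⟨((‖ψ‖⁻¹ : ℝ) : ℂ) • ψ, Submodule.smul_mem _ _ hψ, ?_, ?_⟩
      · rw [norm_smul, Complex.norm_of_nonneg (by positivity), inv_mul_cancel₀ hn]
      · change inner ℂ _ (opH Δ L _) = _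
        rw [map_smul, hev, inner_smul_left, inner_smul_right, inner_smul_right,
          inner_self_eq_norm_sq_to_K, Complex.conj_ofReal]
        have hn' : ((‖ψ‖ : ℝ) : ℂ) ≠ 0 := by exact_mod_cast hn
        push_cast
        field_simp
        exact mul_comm _ _
    · rintro e' ⟨v, hv, hv1, he'⟩
      have h1 := hmin v hv
      change inner ℂ v (opH Δ L v) = _ at he'
      rw [he', hv1] at h1
      simpa using h1
  have heq : minEnergy Δ L n = e := hleast.csInf_eq
  rw [heq]
  exact ⟨hleast, exists_top_eigenvector hq hq1 hΔq h hψ hψ0 hev, hmin⟩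

theorem minEnergy_succ_lt {Δ : ℝ} (hΔ : 1 ≤ Δ) {M n : ℕ} (h : 2 * (n + 1) ≤ M + 1) :
    minEnergy Δ (M + 2) (n + 1) < minEnergy Δ (M + 1) (n + 1) := by
  obtain ⟨hq, hq1, hΔq⟩ := (qParam_unique hΔ _).2 rfl
  obtain ⟨-, ⟨φ, hφ, hφ0, hev⟩, -⟩ := isLeast_energies hΔ h
  have h' : 2 * (n + 1) ≤ M + 2 := by omega
  obtain ⟨-, ⟨φ', hφ', hφ0', hev'⟩, hmin'⟩ := isLeast_energies hΔ h'
  set e := minEnergy Δ (M + 1) (n + 1)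
  set e' := minEnergy Δ (M + 2) (n + 1)
  set q := qParam Δ
  obtain ⟨C, hC, hCb⟩ := exists_norm_le (opH Δ (M + 1))
  obtain ⟨C', hC', hCb'⟩ := exists_norm_le (opH Δ (M + 2))
  -- `K` exceeds both operator norms, so that `K - H` is positive on both chains.
  set K : ℝ := C + C' + ((M + 2 : ℕ) : ℝ) + 1 with hKdef
  have hM : (0 : ℝ) ≤ ((M + 2 : ℕ) : ℝ) := by positivity
  have hK : ((M + 2 : ℕ) : ℝ) + 1 ≤ K := by rw [hKdef]; linarith
  have hbound : ∀ {L : ℕ} {c e : ℝ} {φ : Space L}, φ ≠ 0 → (∀ v, ‖opH Δ L v‖ ≤ c * ‖v‖) →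
      opH Δ L φ = (e : ℂ) • φ → e ≤ c := by
    intro L c e φ h0 hb h
    have h1 := hb φ
    rw [h, norm_smul] at h1
    have h2 := le_of_mul_le_mul_right h1 (norm_pos_iff.2 h0)
    rw [Complex.norm_real] at h2
    exact (le_abs_self e).trans h2
  have he : e ≤ C := hbound hφ0 hCb hev
  have he' : e' ≤ C' := hbound hφ0' hCb' hev'
  have hμ : 0 ≤ K - e := by rw [hKdef]; linarith
  have hμ' : 0 < K - e' := by rw [hKdef]; linarith
  obtain ⟨v, hv, N, δ, c, hδ, hc, hgrow⟩ := exists_growth hq hq1 hΔq hK hφ hφ0 (μ := K - e)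
    (by simp only [LinearMap.sub_apply, LinearMap.smul_apply, Module.End.one_apply, hev]
        push_cast; module) hμ
  have hvS : v ∈ sector q (M + 2) (n + 1) := by
    rw [sector_eq_tower hq h']; exact le_tower _ _ hv
  have hre : ∀ v, (inner ℂ v (((K : ℂ) • 1 - opH Δ (M + 2) : Module.End ℂ _) v)).re
      = K * ‖v‖ ^ 2 - (inner ℂ v (opH Δ (M + 2) v)).re := by
    intro v
    simp only [LinearMap.sub_apply, LinearMap.smul_apply, Module.End.one_apply, inner_sub_right,
      inner_smul_right, Complex.sub_re, Complex.re_ofReal_mul]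
    rw [inner_self_eq_norm_sq_to_K]
    norm_cast
  have hupper := fun k => norm_pow_apply_le (sub_opH_isSymmetric Δ K (M + 2))
    (fun v => by
      rw [hre]
      have h1 := (Complex.re_le_norm _).trans
        (norm_inner_le_norm (𝕜 := ℂ) v (opH Δ (M + 2) v))
      have h2 := mul_le_mul_of_nonneg_left (hCb' v) (norm_nonneg v)
      have h3 : C' * ‖v‖ ^ 2 ≤ K * ‖v‖ ^ 2 := by gcongr; rw [hKdef]; linarith
      nlinarith)
    (S := sector q (M + 2) (n + 1))
    (fun v hv => Submodule.sub_mem _ (Submodule.smul_mem _ _ hv)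
      (opH_mem_sector hq hq1 hΔq h' v hv))
    hμ' (fun v hv => by rw [hre]; linarith [hmin' v hv]) hvS k
  have hle : (K - e) ^ N + δ ≤ (K - e') ^ N := by
    refine le_of_forall_pow_le (by positivity) hc (C := ‖v‖) fun k => ?_
    refine (hgrow k).trans ((hupper (N * k)).trans (le_of_eq ?_))
    rw [pow_mul, mul_comm]
  have hlt : (K - e) ^ N < (K - e') ^ N := by linarith
  have := lt_of_pow_lt_pow_left₀ N hμ'.le hlt
  linarith

end XXZ

end

theorem proposition7p1 (Δ : ℝ) (hΔ : 1 ≤ Δ) (L n : ℕ) (hL : 2 ≤ L) (hn : 1 ≤ n)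
    (hnL : n ≤ L / 2) :
    IsLeast (XXZ.energies Δ L n) (XXZ.minEnergy Δ L n) ∧
      IsLeast (XXZ.energies Δ (L + 1) n) (XXZ.minEnergy Δ (L + 1) n) ∧
      XXZ.minEnergy Δ (L + 1) n < XXZ.minEnergy Δ L n := by
  obtain ⟨M, rfl⟩ : ∃ M, L = M + 1 := ⟨L - 1, by omega⟩
  obtain ⟨m, rfl⟩ : ∃ m, n = m + 1 := ⟨n - 1, by omega⟩
  exact ⟨(XXZ.isLeast_energies hΔ (by omega)).1, (XXZ.isLeast_energies hΔ (by omega)).1,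
    XXZ.minEnergy_succ_lt hΔ (by omega)⟩
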